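/- **Theorem 3.1.** Let $a\in\mathbb R\setminus\{0,1,-1\}$, $p\neq 0$ and $k=\left|\frac{a-1}{a+1}\right|$. For $q\in\mathbb R$ let $$H_q(v,(x_0,y_0,z_0))=(x_0\cos v-y_0\sin v,\;x_0\sin v+y_0\cos v,\;z_0+qv)$$ be the helical motion of pitch $q$ about the $z$-axis, and write $H=H_{1/2}$. For $C>0$ set $$h(s)=\frac{2Cs^{k+1}}{s^2+1},\qquad I_C=\{s>0:\ h(s)>1\},$$ $$g(s)=\frac{(k-1)s^2-(k+1)}{4ks}\sqrt{h(s)},\qquad t(s)=\sqrt{h(s)-1}\qquad(s\in I_C),$$ $$X_0(s)=\Bigl(\tfrac{t(s)}2,\,g(s),\,\int\tfrac{g'(s)}{t(s)}\,ds\Bigr),\qquad X_1(s)=\Bigl(-\tfrac{t(s)}2,\,g(s),\,-\int\tfrac{g'(s)}{t(s)}\,ds\Bigr),$$ where $\int\frac{g'}{t}\,ds$ is an antiderivative on $I_C$; its constant may be chosen separately for $X_0$ and $X_1$. A surface is said to have principal curvature ratio $a$ at a point if its principal curvatures there, in a suitable order, satisfy $\kappa_2\neq0$ and $\kappa_1/\kappa_2=a$.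 (i) Let $c$ be a $C^2$ curve on a nonempty open interval $J$ such that the helical surface $X(v,u)=H_p(v,c(u))$, $v\in\mathbb R$, $u\in J$, of pitch $p$ is regular and has principal curvature ratio $a$ at all its points. Then there is at most one $u_0\in J$ for which the tangent planes of $X$ along the helix $v\mapsto X(v,u_0)$ are parallel to the $z$-axis. Moreover there are a constant $C>0$ and a choice of the antiderivatives in $X_0,X_1$ such that, on $J\setminus\{u_0\}$ (on $J$ if there is no such $u_0$), there are an index $i(u)\in\{0,1\}$, constant on each component, and $C^1$ functions $\sigma,\varphi$ with $\sigma(u)\in I_C$, $\sigma'(u)\neq0$ and $$X(v,u)=2p\,H\bigl(v+\varphi(u),\,X_{i(u)}(\sigma(u))\bigr)\qquad\text{for all }v\in\mathbb R.$$ That is, off this one helix $X$ is, up to reparametrization, a part of the surfaces $2p\,H(v,X_i(s))$, $s\in I_C$, $i=0,1$. (ii) Conversely, for every $C>0$, every choice of the antiderivative and $i\in\{0,1\}$, the surface $2p\,H(v,X_i(s))$, $v\in\mathbb R$, $s\in I_C$, is regular and has principal curvature ratio $a$ at every $(v,s)$ with $(k-1)s^2+k+1\neq0$. -/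

import Mathlib

noncomputable section

namespace HelicalCRPC

/-- Euclidean 3-space with Cartesian coordinates `x = P 0`, `y = P 1`, `z = P 2`. -/
abbrev E3 : Type := EuclideanSpace ℝ (Fin 3)

/-- The helical motion of pitch `p` about the `z`-axis, at rotation angle `v`, applied to `P`. -/
def helicalMotion (p v : ℝ) (P : E3) : E3 :=
  !₂[P 0 * Real.cos v - P 1 * Real.sin v, P 0 * Real.sin v + P 1 * Real.cos v, P 2 + p * v]

/-- The helical surface of pitch `p` generated by the curve `c`, as a parametrized surface. -/
def helicalSurface (p : ℝ) (c : ℝ → E3) : ℝ → ℝ → E3 :=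
  fun v u => helicalMotion p v (c u)

/-! ### Curvature of parametrized surfaces in Euclidean 3-space -/

/-- Partial derivative in the first parameter. -/
def partialFst (Φ : ℝ → ℝ → E3) : ℝ → ℝ → E3 :=
  fun v u => deriv (fun x => Φ x u) v

/-- Partial derivative in the second parameter. -/
def partialSnd (Φ : ℝ → ℝ → E3) : ℝ → ℝ → E3 :=
  fun v u => deriv (fun y => Φ v y) u

/-- The parametrization is an immersion at `(v, u)`. -/
def IsRegularAt (Φ : ℝ → ℝ → E3) (v u : ℝ) : Prop :=
  LinearIndependent ℝ ![partialFst Φ v u, partialSnd Φ v u]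

/-- The tangent plane at `(v, u)`, as a linear subspace. -/
def tangentPlane (Φ : ℝ → ℝ → E3) (v u : ℝ) : Submodule ℝ E3 :=
  Submodule.span ℝ {partialFst Φ v u, partialSnd Φ v u}

/-- The cross product of the two partial derivatives. -/
def normalVector (Φ : ℝ → ℝ → E3) (v u : ℝ) : E3 :=
  WithLp.toLp 2
    (crossProduct (WithLp.ofLp (partialFst Φ v u)) (WithLp.ofLp (partialSnd Φ v u)))

/-- The unit normal (at regular points). -/
def unitNormal (Φ : ℝ → ℝ → E3) (v u : ℝ) : E3 :=
  ‖normalVector Φ v u‖⁻¹ • normalVector Φ v u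

/-- Matrix of the first fundamental form. -/
def firstForm (Φ : ℝ → ℝ → E3) (v u : ℝ) : Matrix (Fin 2) (Fin 2) ℝ :=
  !![inner ℝ (partialFst Φ v u) (partialFst Φ v u), inner ℝ (partialFst Φ v u) (partialSnd Φ v u);
     inner ℝ (partialFst Φ v u) (partialSnd Φ v u), inner ℝ (partialSnd Φ v u) (partialSnd Φ v u)]

/-- Matrix of the second fundamental form with respect to `unitNormal`. -/
def secondForm (Φ : ℝ → ℝ → E3) (v u : ℝ) : Matrix (Fin 2) (Fin 2) ℝ :=
  !![inner ℝ (unitNormal Φ v u) (partialFst (partialFst Φ) v u),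
       inner ℝ (unitNormal Φ v u) (partialFst (partialSnd Φ) v u);
     inner ℝ (unitNormal Φ v u) (partialFst (partialSnd Φ) v u),
       inner ℝ (unitNormal Φ v u) (partialSnd (partialSnd Φ) v u)]

/-- Matrix of the shape operator in the basis of partial derivatives. -/
def shapeMatrix (Φ : ℝ → ℝ → E3) (v u : ℝ) : Matrix (Fin 2) (Fin 2) ℝ :=
  (firstForm Φ v u)⁻¹ * secondForm Φ v u

/-- The principal curvatures at `(v, u)`: the eigenvalues of the shape operator, counted with
multiplicity. -/
def principalCurvatures (Φ : ℝ → ℝ → E3) (v u : ℝ) : Multiset ℝ :=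
  (shapeMatrix Φ v u).charpoly.roots

/-- At `(v, u)` the principal curvatures, in a suitable order, are `κ₁, κ₂` with `κ₁ / κ₂ = a`. -/
def HasCurvatureRatioAt (Φ : ℝ → ℝ → E3) (a v u : ℝ) : Prop :=
  ∃ κ₁ κ₂ : ℝ, principalCurvatures Φ v u = {κ₁, κ₂} ∧ κ₂ ≠ 0 ∧ κ₁ / κ₂ = a

/-! ### The explicit profile curves -/

/-- The parameter `k = |(a - 1) / (a + 1)|`. -/
def ratioParam (a : ℝ) : ℝ := |(a - 1) / (a + 1)|

/-- `h(s) = 2 C s ^ (k + 1) / (s² + 1)`. -/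
def hFun (k C s : ℝ) : ℝ := 2 * C * s ^ (k + 1) / (s ^ 2 + 1)

/-- The parameter domain `I_C = {s > 0 : h(s) > 1}`. -/
def domainI (k C : ℝ) : Set ℝ := {s | 0 < s ∧ 1 < hFun k C s}

/-- `g(s) = ((k - 1) s² - (k + 1)) / (4 k s) * √h(s)`. -/
def gFun (k C s : ℝ) : ℝ :=
  ((k - 1) * s ^ 2 - (k + 1)) / (4 * k * s) * Real.sqrt (hFun k C s)

/-- `t(s) = √(h(s) - 1)`. -/
def tFun (k C s : ℝ) : ℝ := Real.sqrt (hFun k C s - 1)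

/-- `Z` is an antiderivative `∫ g'(s) / t(s) ds` on `I_C`. -/
def IsHeight (k C : ℝ) (Z : ℝ → ℝ) : Prop :=
  ∀ s ∈ domainI k C, HasDerivAt Z (deriv (gFun k C) s / tFun k C s) s

/-- The profile curves `X₀ = (t / 2, g, Z)` and `X₁ = (-t / 2, g, -Z)`. -/
def profileCurve (k C : ℝ) (Z : ℝ → ℝ) (i : Fin 2) (s : ℝ) : E3 :=
  match i with
  | 0 => !₂[tFun k C s / 2, gFun k C s, Z s]
  | 1 => !₂[-(tFun k C s / 2), gFun k C s, -(Z s)]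

/-- The explicit surface `(v, s) ↦ 2 p H(v, X_i(s))`, with `H` the helical motion of pitch `1/2`. -/
def explicitSurface (p k C : ℝ) (Z : ℝ → ℝ) (i : Fin 2) : ℝ → ℝ → E3 :=
  fun v s => (2 * p) • helicalMotion (1 / 2) v (profileCurve k C Z i s)

/-- The parameters `u ∈ J` along whose helix the tangent planes of the helical surface are parallel
to the `z`-axis (the tangent planes along a helix are rotated copies of the one at `v = 0`). -/
def axialParams (p : ℝ) (c : ℝ → E3) (J : Set ℝ) : Set ℝ :=
  {u ∈ J | !₂[(0 : ℝ), 0, 1] ∈ tangentPlane (helicalSurface p c) 0 u}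

end HelicalCRPC

end

noncomputable section
namespace HelicalCRPC

/-! A point of the profile curve may slide along its helix without changing the surface. Regularity
and `p ≠ 0` make the horizontal part of the normal nowhere zero, so there is a C¹ angle `φ` for
which the normal along the slid profile `p (ξ, ζ, τ)` has first coordinate zero, that is, `ζ' = ξ
τ'`. The normal is then proportional to `(0, 1, -ξ)` in the rotated frame. Since `n · c'' = -n' ·
c'`, the ratio condition involves only first derivatives of `ξ` and `τ`, although the slid profile
is merely C¹ (`exists_reduced_profile`). The tangent plane contains the axis direction exactly where
`ξ = 0`, and the ratio condition with `a ≠ 0` forces `ξ' ≠ 0`; hence there is at most one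
exceptional helix.

Put `ω = √(1 + ξ²)`, `η = ζ / ω` and `δ = (ω² τ' - ξ' ζ) / (ξ' ω)`. The ratio condition becomes the
conic `(k² - 1) δ² = 4 (1 + η δ + η²)`. A half-turn of the frame reaches the branch `δ > 0`, which
`conic_parametrization` describes rationally by a parameter `s`. The equation `η' = ξ ξ' δ / ω²`
then separates and integrates to `ω² = h(s)`, with `C` as constant of integration
(`IsReducedProfile.exists_parameter`). So `ξ = ±t(s)` and `ζ = 2 g(s)`, and `ζ' = ξ τ'` yields `τ =
±2 ∫ g' / t` (`IsReducedProfile.exists_height`).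

For the converse, the explicit profiles already satisfy `ζ' = ξ τ'`, so the same first-order
criterion is checked on them by substitution (`explicitSurface_regular_and_ratio`). -/

/-! ### Partial derivatives of helical surfaces -/

theorem hasDerivAt_vec3 {f g h : ℝ → ℝ} {f' g' h' t : ℝ} (hf : HasDerivAt f f' t)
    (hg : HasDerivAt g g' t) (hh : HasDerivAt h h' t) :
    HasDerivAt (fun t => (!₂[f t, g t, h t] : E3)) !₂[f', g', h'] t := by
  have : HasDerivAt (fun t => (![f t, g t, h t] : Fin 3 → ℝ)) ![f', g', h'] t := by
    rw [hasDerivAt_pi]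
    intro i
    fin_cases i
    exacts [hf, hg, hh]
  exact (PiLp.continuousLinearEquiv 2 ℝ (fun _ : Fin 3 => ℝ)).symm.hasFDerivAt.comp_hasDerivAt t this

theorem hasDerivAt_coord {c : ℝ → E3} {c' : E3} {t : ℝ} (hc : HasDerivAt c c' t) (i : Fin 3) :
    HasDerivAt (fun t => c t i) (c' i) t := by
  exact (EuclideanSpace.proj i : E3 →L[ℝ] ℝ).hasFDerivAt.comp_hasDerivAt t hc

theorem partialFst_helicalSurface (p : ℝ) (c : ℝ → E3) :
    partialFst (helicalSurface p c) = fun v u =>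
      !₂[-(c u 0 * Real.sin v) - c u 1 * Real.cos v, c u 0 * Real.cos v - c u 1 * Real.sin v, p] := by
  funext v u
  have := hasDerivAt_vec3
    (((Real.hasDerivAt_cos v).const_mul (c u 0)).sub ((Real.hasDerivAt_sin v).const_mul (c u 1)))
    (((Real.hasDerivAt_sin v).const_mul (c u 0)).add ((Real.hasDerivAt_cos v).const_mul (c u 1)))
    (((hasDerivAt_id v).const_mul p).const_add (c u 2))
  refine this.deriv.trans ?_
  congr 2
  simp
  grind

theorem partialSnd_helicalSurface {p : ℝ} {c : ℝ → E3} {c' : E3} {u : ℝ}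
    (hc : HasDerivAt c c' u) (v : ℝ) :
    partialSnd (helicalSurface p c) v u =
      !₂[c' 0 * Real.cos v - c' 1 * Real.sin v, c' 0 * Real.sin v + c' 1 * Real.cos v, c' 2] := by
  have := hasDerivAt_vec3
    (((hasDerivAt_coord hc 0).mul_const (Real.cos v)).sub
      ((hasDerivAt_coord hc 1).mul_const (Real.sin v)))
    (((hasDerivAt_coord hc 0).mul_const (Real.sin v)).add
      ((hasDerivAt_coord hc 1).mul_const (Real.cos v)))
    ((hasDerivAt_coord hc 2).add_const (p * v))
  exact this.deriv

theorem partialFst_partialFst_helicalSurface (p : ℝ) (c : ℝ → E3) (v u : ℝ) :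
    partialFst (partialFst (helicalSurface p c)) v u =
      !₂[-(c u 0 * Real.cos v) + c u 1 * Real.sin v, -(c u 0 * Real.sin v) - c u 1 * Real.cos v, 0] := by
  rw [partialFst_helicalSurface]
  have := hasDerivAt_vec3
    (((Real.hasDerivAt_sin v).const_mul (c u 0)).neg.sub ((Real.hasDerivAt_cos v).const_mul (c u 1)))
    (((Real.hasDerivAt_cos v).const_mul (c u 0)).sub ((Real.hasDerivAt_sin v).const_mul (c u 1)))
    (hasDerivAt_const v p)
  refine this.deriv.trans ?_
  congr 2
  simp
  grind

theorem partialFst_partialSnd_helicalSurface {p : ℝ} {c : ℝ → E3} {c' : E3} {u : ℝ}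
    (hc : HasDerivAt c c' u) (v : ℝ) :
    partialFst (partialSnd (helicalSurface p c)) v u =
      !₂[-(c' 0 * Real.sin v) - c' 1 * Real.cos v, c' 0 * Real.cos v - c' 1 * Real.sin v, 0] := by
  have h : (fun x => partialSnd (helicalSurface p c) x u) = fun v =>
      !₂[c' 0 * Real.cos v - c' 1 * Real.sin v, c' 0 * Real.sin v + c' 1 * Real.cos v, c' 2] :=
    funext fun v => partialSnd_helicalSurface hc v
  have := hasDerivAt_vec3
    (((Real.hasDerivAt_cos v).const_mul (c' 0)).sub ((Real.hasDerivAt_sin v).const_mul (c' 1)))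
    (((Real.hasDerivAt_sin v).const_mul (c' 0)).add ((Real.hasDerivAt_cos v).const_mul (c' 1)))
    (hasDerivAt_const v (c' 2))
  unfold partialFst
  rw [h]
  refine this.deriv.trans ?_
  congr 2
  simp
  grind

theorem partialSnd_partialSnd_helicalSurface {p : ℝ} {c c' : ℝ → E3} {c'' : E3} {u : ℝ}
    (hc : ∀ᶠ y in nhds u, HasDerivAt c (c' y) y) (hc' : HasDerivAt c' c'' u) (v : ℝ) :
    partialSnd (partialSnd (helicalSurface p c)) v u =
      !₂[c'' 0 * Real.cos v - c'' 1 * Real.sin v, c'' 0 * Real.sin v + c'' 1 * Real.cos v, c'' 2] := by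
  have h : (fun y => partialSnd (helicalSurface p c) v y) =ᶠ[nhds u] fun y =>
      !₂[c' y 0 * Real.cos v - c' y 1 * Real.sin v, c' y 0 * Real.sin v + c' y 1 * Real.cos v,
        c' y 2] := hc.mono fun y hy => partialSnd_helicalSurface hy v
  have := hasDerivAt_vec3
    (((hasDerivAt_coord hc' 0).mul_const (Real.cos v)).sub
      ((hasDerivAt_coord hc' 1).mul_const (Real.sin v)))
    (((hasDerivAt_coord hc' 0).mul_const (Real.sin v)).add
      ((hasDerivAt_coord hc' 1).mul_const (Real.cos v)))
    (hasDerivAt_coord hc' 2)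
  exact (this.congr_of_eventuallyEq h).deriv

/-! ### The curvature ratio in terms of the fundamental forms -/

/-- The eigenvalues of a real `2 × 2` matrix have ratio `a` iff its trace and determinant are
suitably related. -/
theorem exists_roots_ratio_iff {a : ℝ} (ha : a ≠ -1) (S : Matrix (Fin 2) (Fin 2) ℝ) :
    (∃ κ₁ κ₂ : ℝ, S.charpoly.roots = {κ₁, κ₂} ∧ κ₂ ≠ 0 ∧ κ₁ / κ₂ = a) ↔
      S.trace ≠ 0 ∧ (1 + a) ^ 2 * S.det = a * S.trace ^ 2 := by
  have ha' : 1 + a ≠ 0 := fun h => ha (by linarith)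
  have key : ∀ κ₁ κ₂ : ℝ, S.charpoly.roots = {κ₁, κ₂} ↔ S.trace = κ₁ + κ₂ ∧ S.det = κ₁ * κ₂ := by
    intro κ₁ κ₂
    constructor
    · intro h
      -- Two real roots exhaust the degree, so the polynomial splits and trace and determinant are
      -- their sum and product.
      have hcard : S.charpoly.roots.card = S.charpoly.natDegree := by
        rw [h, Matrix.charpoly_natDegree_eq_dim]; simp
      have hs : S.charpoly.Splits := Polynomial.splits_iff_card_roots.2 hcard
      rw [S.trace_eq_sum_roots_charpoly_of_splits hs, S.det_eq_prod_roots_charpoly_of_splits hs, h]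
      simp
    · rintro ⟨h1, h2⟩
      have : S.charpoly = (Polynomial.X - Polynomial.C κ₁) * (Polynomial.X - Polynomial.C κ₂) := by
        rw [Matrix.charpoly_fin_two, h1, h2]
        simp only [Polynomial.C_add, Polynomial.C_mul]
        ring
      rw [this, Polynomial.roots_mul (mul_ne_zero (Polynomial.X_sub_C_ne_zero _)
        (Polynomial.X_sub_C_ne_zero _)), Polynomial.roots_X_sub_C, Polynomial.roots_X_sub_C]
      rfl
  simp only [key]
  constructor
  · rintro ⟨κ₁, κ₂, ⟨h1, h2⟩, h3, h4⟩
    rw [div_eq_iff h3] at h4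
    subst h4
    rw [h1, h2]
    refine ⟨?_, by ring⟩
    have := mul_ne_zero ha' h3
    intro h; apply this; linarith
  · rintro ⟨h1, h2⟩
    refine ⟨a * (S.trace / (1 + a)), S.trace / (1 + a), ⟨by field_simp; ring, ?_⟩,
      div_ne_zero h1 ha', by field_simp⟩
    field_simp
    linarith

theorem inner_e3 (A B : E3) : inner ℝ A B = A 0 * B 0 + A 1 * B 1 + A 2 * B 2 := by
  simp [PiLp.inner_apply, Fin.sum_univ_three]
  ring

theorem isRegularAt_iff (Φ : ℝ → ℝ → E3) (v u : ℝ) :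
    IsRegularAt Φ v u ↔ normalVector Φ v u ≠ 0 := by
  have h1 : IsRegularAt Φ v u ↔ LinearIndependent ℝ
      ![WithLp.ofLp (partialFst Φ v u), WithLp.ofLp (partialSnd Φ v u)] := by
    unfold IsRegularAt
    rw [← LinearMap.linearIndependent_iff (WithLp.linearEquiv 2 ℝ (Fin 3 → ℝ)).toLinearMap
      (LinearEquiv.ker _)]
    congr! 1
    ext i
    fin_cases i <;> rfl
  rw [h1, ← crossProduct_ne_zero_iff_linearIndependent, normalVector, ne_eq, ne_eq,
    WithLp.toLp_eq_zero]

theorem normalVector_coords (Φ : ℝ → ℝ → E3) (v u : ℝ) :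
    normalVector Φ v u =
      !₂[partialFst Φ v u 1 * partialSnd Φ v u 2 - partialFst Φ v u 2 * partialSnd Φ v u 1,
        partialFst Φ v u 2 * partialSnd Φ v u 0 - partialFst Φ v u 0 * partialSnd Φ v u 2,
        partialFst Φ v u 0 * partialSnd Φ v u 1 - partialFst Φ v u 1 * partialSnd Φ v u 0] := by
  rw [normalVector, cross_apply]

/-- The ratio condition in terms of the coefficients `E, F, G` of the first fundamental form and the
coefficients `L, M, N` of the second one, computed with the normal vector that is not normalized. -/
theorem hasCurvatureRatioAt_iff {a : ℝ} (ha : a ≠ -1) {Φ : ℝ → ℝ → E3} {v u : ℝ}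
    (hn : normalVector Φ v u ≠ 0) {E F G L M N : ℝ}
    (hE : inner ℝ (partialFst Φ v u) (partialFst Φ v u) = E)
    (hF : inner ℝ (partialFst Φ v u) (partialSnd Φ v u) = F)
    (hG : inner ℝ (partialSnd Φ v u) (partialSnd Φ v u) = G)
    (hL : inner ℝ (normalVector Φ v u) (partialFst (partialFst Φ) v u) = L)
    (hM : inner ℝ (normalVector Φ v u) (partialFst (partialSnd Φ) v u) = M)
    (hN : inner ℝ (normalVector Φ v u) (partialSnd (partialSnd Φ) v u) = N) :
    HasCurvatureRatioAt Φ a v u ↔ E * N - 2 * F * M + G * L ≠ 0 ∧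
      (1 + a) ^ 2 * ((L * N - M ^ 2) * (E * G - F ^ 2)) = a * (E * N - 2 * F * M + G * L) ^ 2 := by
  -- Lagrange's identity for the cross product.
  have hW : E * G - F ^ 2 = ‖normalVector Φ v u‖ ^ 2 := by
    rw [← real_inner_self_eq_norm_sq, normalVector_coords, ← hE, ← hF, ← hG]
    simp only [inner_e3]
    simp
    ring
  have hW0 : ‖normalVector Φ v u‖ ≠ 0 := norm_ne_zero_iff.2 hn
  set W := ‖normalVector Φ v u‖ with hWdef
  have hdet : E * G - F * F = W ^ 2 := by rw [← hW]; ring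
  -- Two of the three powers of `W` come from the determinant of the first form, one from
  -- normalizing the normal.
  have hS : shapeMatrix Φ v u = (W ^ 3)⁻¹ • !![G * L - F * M, G * M - F * N;
      E * M - F * L, E * N - F * M] := by
    simp only [shapeMatrix, firstForm, secondForm, unitNormal, real_inner_smul_left, hE, hF, hG, hL,
      hM, hN, ← hWdef]
    rw [Matrix.inv_def, Matrix.adjugate_fin_two_of, Matrix.det_fin_two_of, hdet,
      Ring.inverse_eq_inv']
    ext i j
    fin_cases i <;> fin_cases j <;> simp [Matrix.mul_apply, Fin.sum_univ_two] <;> field_simp <;> ring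
  unfold HasCurvatureRatioAt principalCurvatures
  rw [exists_roots_ratio_iff ha, hS]
  have htr : Matrix.trace ((W ^ 3)⁻¹ • !![G * L - F * M, G * M - F * N;
      E * M - F * L, E * N - F * M]) = (E * N - 2 * F * M + G * L) / W ^ 3 := by
    rw [Matrix.trace_fin_two]
    simp
    field_simp
    ring
  have hd : Matrix.det ((W ^ 3)⁻¹ • !![G * L - F * M, G * M - F * N;
      E * M - F * L, E * N - F * M]) = (L * N - M ^ 2) * W ^ 2 / W ^ 6 := by
    rw [Matrix.det_fin_two]
    simp
    field_simp
    rw [← hdet]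
    ring
  rw [htr, hd, hW]
  refine and_congr (by simp [hW0]) ?_
  rw [div_pow, ← pow_mul, mul_div_assoc', mul_div_assoc', div_left_inj' (by positivity)]

/-! ### Regularity and the ratio condition on helical surfaces -/

theorem normalVector_helicalSurface {p : ℝ} {c : ℝ → E3} {c' : E3} {u : ℝ}
    (hc : HasDerivAt c c' u) (v : ℝ) :
    normalVector (helicalSurface p c) v u =
      !₂[(c u 0 * c' 2 - p * c' 1) * Real.cos v - (p * c' 0 + c u 1 * c' 2) * Real.sin v,
        (c u 0 * c' 2 - p * c' 1) * Real.sin v + (p * c' 0 + c u 1 * c' 2) * Real.cos v,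
        -(c u 0 * c' 0 + c u 1 * c' 1)] := by
  rw [normalVector_coords, partialFst_helicalSurface, partialSnd_helicalSurface hc]
  have := Real.sin_sq_add_cos_sq v
  ext i
  fin_cases i
  · simp; ring
  · simp; ring
  · simp; linear_combination (-(c u 0 * c' 0 + c u 1 * c' 1)) * this

/-- The horizontal components control the third one: `p (x x' + y y') = x n₂ - y n₁`. As `p ≠ 0`, a
normal with vanishing horizontal part vanishes altogether. -/
theorem isRegularAt_helicalSurface_iff {p : ℝ} (hp : p ≠ 0) {c : ℝ → E3} {c' : E3} {u : ℝ}
    (hc : HasDerivAt c c' u) (v : ℝ) :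
    IsRegularAt (helicalSurface p c) v u ↔
      (c u 0 * c' 2 - p * c' 1) ^ 2 + (p * c' 0 + c u 1 * c' 2) ^ 2 ≠ 0 := by
  rw [isRegularAt_iff, not_iff_not, normalVector_helicalSurface hc]
  have h := Real.sin_sq_add_cos_sq v
  set n₁ := c u 0 * c' 2 - p * c' 1 with hn₁
  set n₂ := p * c' 0 + c u 1 * c' 2 with hn₂
  constructor
  · intro h0
    have h1 := congrArg (fun P : E3 => P 0) h0
    have h2 := congrArg (fun P : E3 => P 1) h0
    simp at h1 h2
    linear_combination (n₁ * Real.cos v - n₂ * Real.sin v) * h1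
      + (n₁ * Real.sin v + n₂ * Real.cos v) * h2 - (n₁ ^ 2 + n₂ ^ 2) * h
  · intro h0
    have h1 : n₁ = 0 := by nlinarith [sq_nonneg n₁, sq_nonneg n₂]
    have h2 : n₂ = 0 := by nlinarith [sq_nonneg n₁, sq_nonneg n₂]
    have h3 : c u 0 * c' 0 + c u 1 * c' 1 = 0 := by
      apply mul_left_cancel₀ hp
      linear_combination c u 0 * (h2 - hn₂) - c u 1 * (h1 - hn₁)
    rw [h1, h2, h3]
    ext i
    fin_cases i <;> simp

/-- The helical motions are isometries, so `v` drops out of all six coefficients. These enter as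
equations, which lets a caller either take them by `rfl` or rewrite them in another frame. -/
theorem hasCurvatureRatioAt_helicalSurface_iff {a p : ℝ} (ha : a ≠ -1) {c c' : ℝ → E3}
    {c'' : E3} {u v : ℝ}
    (hc : ∀ᶠ y in nhds u, HasDerivAt c (c' y) y) (hc' : HasDerivAt c' c'' u)
    (hreg : IsRegularAt (helicalSurface p c) v u)
    {x y x₁ y₁ z₁ n₁ n₂ n₃ E F G L M N : ℝ} (hx : c u 0 = x) (hy : c u 1 = y)
    (hx₁ : c' u 0 = x₁) (hy₁ : c' u 1 = y₁) (hz₁ : c' u 2 = z₁)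
    (hn₁ : x * z₁ - p * y₁ = n₁) (hn₂ : p * x₁ + y * z₁ = n₂) (hn₃ : -(x * x₁ + y * y₁) = n₃)
    (hE : x ^ 2 + y ^ 2 + p ^ 2 = E) (hF : x * y₁ - y * x₁ + p * z₁ = F)
    (hG : x₁ ^ 2 + y₁ ^ 2 + z₁ ^ 2 = G) (hL : -(n₁ * x) - n₂ * y = L)
    (hM : n₂ * x₁ - n₁ * y₁ = M) (hN : n₁ * c'' 0 + n₂ * c'' 1 + n₃ * c'' 2 = N) :
    HasCurvatureRatioAt (helicalSurface p c) a v u ↔ E * N - 2 * F * M + G * L ≠ 0 ∧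
      (1 + a) ^ 2 * ((L * N - M ^ 2) * (E * G - F ^ 2)) = a * (E * N - 2 * F * M + G * L) ^ 2 := by
  have hcu := hc.self_of_nhds
  have h := Real.sin_sq_add_cos_sq v
  subst hE hF hG hL hM hN hn₁ hn₂ hn₃ hx hy hx₁ hy₁ hz₁
  apply hasCurvatureRatioAt_iff ha ((isRegularAt_iff _ _ _).1 hreg)
  · rw [partialFst_helicalSurface, inner_e3]
    simp
    linear_combination (c u 0 ^ 2 + c u 1 ^ 2) * h
  · rw [partialFst_helicalSurface, partialSnd_helicalSurface hcu, inner_e3]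
    simp
    linear_combination (c u 0 * c' u 1 - c u 1 * c' u 0) * h
  · rw [partialSnd_helicalSurface hcu, inner_e3]
    simp
    linear_combination (c' u 0 ^ 2 + c' u 1 ^ 2) * h
  · rw [partialFst_partialFst_helicalSurface, normalVector_helicalSurface hcu, inner_e3]
    simp
    linear_combination (-((c u 0 * c' u 2 - p * c' u 1) * c u 0)
      - (p * c' u 0 + c u 1 * c' u 2) * c u 1) * h
  · rw [partialFst_partialSnd_helicalSurface hcu, normalVector_helicalSurface hcu, inner_e3]
    simp
    linear_combination ((p * c' u 0 + c u 1 * c' u 2) * c' u 0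
      - (c u 0 * c' u 2 - p * c' u 1) * c' u 1) * h
  · rw [partialSnd_partialSnd_helicalSurface hc hc', normalVector_helicalSurface hcu, inner_e3]
    simp
    linear_combination ((c u 0 * c' u 2 - p * c' u 1) * c'' 0
      + (p * c' u 0 + c u 1 * c' u 2) * c'' 1) * h

/-! ### The rotating frame and the axial tangent planes -/

/-- The ratio condition for a profile curve written as `p • (ξ, ζ, τ)` in a moving frame rotating
with angular speed `ψ`, such that the first coordinate of the normal vanishes. -/
theorem ratio_condition_iff_reduced {a p ξ ζ ξ₁ m ψ ρ E F G L M N : ℝ} (hp : p ≠ 0)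
    (hρ : ξ₁ + ζ * m ≠ 0) (hρ' : ρ = p ^ 2 * (ξ₁ + ζ * m))
    (hE : E = p ^ 2 * (ξ ^ 2 + ζ ^ 2 + 1))
    (hF : F = p ^ 2 * (ξ * (ξ * (m + ψ)) - ζ * (ξ₁ - ζ * ψ) + (m + ψ)))
    (hG : G = p ^ 2 * ((ξ₁ - ζ * ψ) ^ 2 + (ξ * (m + ψ)) ^ 2 + (m + ψ) ^ 2))
    (hL : L = -(ρ * p * ζ)) (hM : M = ρ * p * (ξ₁ - ζ * ψ))
    (hN : N = ρ * p * (ψ * (ξ₁ - ζ * ψ) + ξ₁ * (m + ψ))) :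
    (E * N - 2 * F * M + G * L ≠ 0 ∧
      (1 + a) ^ 2 * ((L * N - M ^ 2) * (E * G - F ^ 2)) = a * (E * N - 2 * F * M + G * L) ^ 2) ↔
    ((1 + ξ ^ 2) * m - ξ₁ * ζ ≠ 0 ∧
      -((1 + a) ^ 2 * ((1 + ξ ^ 2) * ξ₁ * (ξ₁ + ζ * m))) = a * ((1 + ξ ^ 2) * m - ξ₁ * ζ) ^ 2) := by
  -- The angular speed `ψ` cancels from both invariants: it only records how the profile slides
  -- along the helices.
  have h1 : E * N - 2 * F * M + G * L =
      -(p ^ 5 * (ξ₁ + ζ * m) ^ 2) * ((1 + ξ ^ 2) * m - ξ₁ * ζ) := by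
    subst hρ' hE hF hG hL hM hN; ring
  have h2 : (L * N - M ^ 2) * (E * G - F ^ 2) =
      (p ^ 5 * (ξ₁ + ζ * m) ^ 2) ^ 2 * -((1 + ξ ^ 2) * ξ₁ * (ξ₁ + ζ * m)) := by
    subst hρ' hE hF hG hL hM hN; ring
  have h3 : p ^ 5 * (ξ₁ + ζ * m) ^ 2 ≠ 0 := by positivity
  rw [h1, h2]
  generalize p ^ 5 * (ξ₁ + ζ * m) ^ 2 = q at h3 ⊢
  refine and_congr (by simp [h3]) ⟨fun h => ?_, fun h => ?_⟩
  · apply mul_left_cancel₀ (pow_ne_zero 2 h3)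
    linear_combination h
  · linear_combination q ^ 2 * h

/-- A `C¹` choice of polar angle for a nowhere vanishing planar vector field along an interval. -/
theorem exists_polar_angle {J : Set ℝ} (hJ : IsOpen J) (hJc : IsConnected J)
    {n₁ n₂ n₁' n₂' : ℝ → ℝ} (h₁ : ∀ u ∈ J, HasDerivAt n₁ (n₁' u) u)
    (h₂ : ∀ u ∈ J, HasDerivAt n₂ (n₂' u) u) (h₁' : ContinuousOn n₁' J) (h₂' : ContinuousOn n₂' J)
    (hn : ∀ u ∈ J, n₁ u ^ 2 + n₂ u ^ 2 ≠ 0) :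
    ∃ φ : ℝ → ℝ, (∀ u ∈ J, HasDerivAt φ
        ((n₁ u * n₂' u - n₂ u * n₁' u) / (n₁ u ^ 2 + n₂ u ^ 2)) u) ∧
      ∀ u ∈ J, n₁ u * Real.cos (φ u) + n₂ u * Real.sin (φ u) = 0 := by
  obtain ⟨u₀, hu₀⟩ := hJc.nonempty
  have hord : Set.OrdConnected J := hJc.isPreconnected.ordConnected
  set f : ℝ → ℝ := fun u => (n₁ u * n₂' u - n₂ u * n₁' u) / (n₁ u ^ 2 + n₂ u ^ 2) with hf
  have c₁ : ContinuousOn n₁ J := fun u hu => (h₁ u hu).continuousAt.continuousWithinAt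
  have c₂ : ContinuousOn n₂ J := fun u hu => (h₂ u hu).continuousAt.continuousWithinAt
  have hfc : ContinuousOn f J :=
    ((c₁.mul h₂').sub (c₂.mul h₁')).div ((c₁.pow 2).add (c₂.pow 2)) hn
  have hint : ∀ u ∈ J, HasDerivAt (fun u => ∫ t in u₀..u, f t) (f u) u := by
    intro u hu
    have hsub : Set.uIcc u₀ u ⊆ J := hord.uIcc_subset hu₀ hu
    exact intervalIntegral.integral_hasDerivAt_right ((hfc.mono hsub).intervalIntegrable)
      (hfc.stronglyMeasurableAtFilter hJ u hu) (hfc.continuousAt (hJ.mem_nhds hu))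
  obtain ⟨φ₀, hφ₀⟩ : ∃ φ₀ : ℝ, n₁ u₀ * Real.cos φ₀ + n₂ u₀ * Real.sin φ₀ = 0 := by
    -- The initial direction `(cos φ₀, sin φ₀)` is that of `(n₂, -n₁)`, orthogonal to `(n₁, n₂)`.
    refine ⟨Complex.arg (⟨n₂ u₀, -n₁ u₀⟩ : ℂ), ?_⟩
    have h0 : (⟨n₂ u₀, -n₁ u₀⟩ : ℂ) ≠ 0 := by
      intro h
      apply hn u₀ hu₀
      have h1 := congrArg Complex.re h
      have h2 := congrArg Complex.im h
      have h1' : n₂ u₀ = 0 := h1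
      have h2' : -n₁ u₀ = 0 := h2
      rw [h1', neg_eq_zero.1 h2']
      simp
    rw [Complex.cos_arg h0, Complex.sin_arg]
    ring
  set φ : ℝ → ℝ := fun u => φ₀ + ∫ t in u₀..u, f t with hφ
  have hφd : ∀ u ∈ J, HasDerivAt φ (f u) u := fun u hu => (hint u hu).const_add φ₀
  refine ⟨φ, hφd, ?_⟩
  set Q : ℝ → ℝ := fun u => n₁ u * Real.cos (φ u) + n₂ u * Real.sin (φ u) with hQ
  set R : ℝ → ℝ := fun u => n₁ u ^ 2 + n₂ u ^ 2 with hR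
  -- `Q² / R` is the squared cosine of the angle between the field and the direction `φ`. Both turn
  -- with angular speed `f`, so it stays at its initial value zero.
  have hd : ∀ u ∈ J, HasDerivAt (fun u => Q u ^ 2 / R u) 0 u := by
    intro u hu
    have e1 : HasDerivAt Q _ u := ((h₁ u hu).mul (hφd u hu).cos).add ((h₂ u hu).mul (hφd u hu).sin)
    have e2 : HasDerivAt R _ u := ((h₁ u hu).pow 2).add ((h₂ u hu).pow 2)
    refine ((e1.pow 2).div e2 (hn u hu)).congr_deriv ?_
    have hRu : n₁ u ^ 2 + n₂ u ^ 2 ≠ 0 := hn u hu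
    simp only [hQ, hR, hf, Pi.pow_apply]
    field_simp
    ring
  have hconst : ∀ u ∈ J, Q u ^ 2 / R u = Q u₀ ^ 2 / R u₀ := by
    intro u hu
    exact hJ.is_const_of_deriv_eq_zero hJc.isPreconnected
      (fun x hx => (hd x hx).differentiableAt.differentiableWithinAt)
      (fun x hx => (hd x hx).deriv) hu hu₀
  intro u hu
  have h := hconst u hu
  have h0 : Q u₀ = 0 := by simp [hQ, hφ, hφ₀]
  rw [h0] at h
  simpa [hR, hn u hu] using h

/-- The axis direction is tangent exactly when it is orthogonal to the normal, whose third component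
is `-(x x' + y y')`. -/
theorem mem_tangentPlane_axis_iff {p : ℝ} (hp : p ≠ 0) {c : ℝ → E3} {c' : E3} {u : ℝ}
    (hc : HasDerivAt c c' u) (hreg : IsRegularAt (helicalSurface p c) 0 u) :
    !₂[(0 : ℝ), 0, 1] ∈ tangentPlane (helicalSurface p c) 0 u ↔
      c u 0 * c' 0 + c u 1 * c' 1 = 0 := by
  rw [isRegularAt_helicalSurface_iff hp hc] at hreg
  rw [tangentPlane, partialFst_helicalSurface, partialSnd_helicalSurface hc,
    Submodule.mem_span_pair]
  simp only [Real.cos_zero, Real.sin_zero, mul_zero, mul_one, neg_zero, zero_sub, sub_zero, zero_add]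
  generalize c u 0 = x at *
  generalize c u 1 = y at *
  generalize c' 0 = x₁ at *
  generalize c' 1 = y₁ at *
  generalize c' 2 = z₁ at *
  constructor
  · rintro ⟨α, β, h⟩
    have h0 := congrArg (fun P : E3 => P 0) h
    have h1 := congrArg (fun P : E3 => P 1) h
    have h2 := congrArg (fun P : E3 => P 2) h
    simp at h0 h1 h2
    linear_combination -(x * x₁ + y * y₁) * h2 + (x * z₁ - p * y₁) * h0 + (p * x₁ + y * z₁) * h1
  · intro h
    have key : ∀ α β : ℝ, -(α * y) + β * x₁ = 0 → α * x + β * y₁ = 0 → α * p + β * z₁ ≠ 0 →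
        ∃ α β : ℝ, α • (!₂[-y, x, p] : E3) + β • !₂[x₁, y₁, z₁] = !₂[0, 0, 1] := by
      intro α β h0 h1 h2
      refine ⟨α / (α * p + β * z₁), β / (α * p + β * z₁), ?_⟩
      ext i
      fin_cases i
      · simp; field_simp; linarith
      · simp; field_simp; linarith
      · simp; field_simp
    -- On the axis the helix itself is vertical. Elsewhere the coefficients subtract from the
    -- profile tangent its component along the horizontal part of the helix tangent, scaled to clear
    -- denominators.
    by_cases hr : x ^ 2 + y ^ 2 = 0
    · have hx : x = 0 := by nlinarith [sq_nonneg x, sq_nonneg y]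
      have hy : y = 0 := by nlinarith [sq_nonneg x, sq_nonneg y]
      exact key 1 0 (by simp [hy]) (by simp [hx]) (by simpa using hp)
    · refine key (-(x * y₁ - y * x₁)) (x ^ 2 + y ^ 2) (by linear_combination x * h)
        (by linear_combination y * h) ?_
      intro h0
      apply hreg
      have e1 : (x ^ 2 + y ^ 2) * (x * z₁ - p * y₁) = 0 := by
        linear_combination x * h0 - p * y * h
      have e2 : (x ^ 2 + y ^ 2) * (p * x₁ + y * z₁) = 0 := by
        linear_combination y * h0 + p * x * h
      rw [(mul_eq_zero.1 e1).resolve_left hr, (mul_eq_zero.1 e2).resolve_left hr]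
      simp

/-! ### Reduction to a first-order profile equation -/

/-- A curve `(ξ, ζ, τ)` with derivative `(ξ', ξ τ', τ')` on `J` such that the helical surface of pitch
`1` through it has principal curvature ratio `a`, oriented by a choice of sign. -/
structure IsReducedProfile (a : ℝ) (J : Set ℝ) (ξ ζ τ ξ' τ' : ℝ → ℝ) : Prop where
  hasDerivAt_fst : ∀ u ∈ J, HasDerivAt ξ (ξ' u) u
  hasDerivAt_snd : ∀ u ∈ J, HasDerivAt ζ (ξ u * τ' u) u
  hasDerivAt_height : ∀ u ∈ J, HasDerivAt τ (τ' u) u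
  continuousOn_fst : ContinuousOn ξ' J
  continuousOn_height : ContinuousOn τ' J
  ratio : ∀ u ∈ J, -((1 + a) ^ 2 * ((1 + ξ u ^ 2) * ξ' u * (ξ' u + ζ u * τ' u))) =
    a * ((1 + ξ u ^ 2) * τ' u - ξ' u * ζ u) ^ 2
  pos : ∀ u ∈ J, 0 < ((1 + ξ u ^ 2) * τ' u - ξ' u * ζ u) * ξ' u

theorem helicalMotion_add (p v w : ℝ) (P : E3) :
    helicalMotion p (v + w) P = helicalMotion p v (helicalMotion p w P) := by
  unfold helicalMotion
  ext i
  fin_cases i <;> simp [Real.cos_add, Real.sin_add] <;> ring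

theorem hasDerivAt_of_contDiffOn_two {J : Set ℝ} (hJ : IsOpen J) {c : ℝ → E3}
    (hc : ContDiffOn ℝ 2 c J) :
    (∀ u ∈ J, HasDerivAt c (deriv c u) u) ∧ (∀ u ∈ J, HasDerivAt (deriv c) (deriv (deriv c) u) u) ∧
      ContinuousOn (deriv (deriv c)) J := by
  have h2 : ContDiffOn ℝ (1 + 1) c J := by rwa [one_add_one_eq_two]
  rw [contDiffOn_succ_iff_deriv_of_isOpen hJ] at h2
  have h1 : ContDiffOn ℝ (0 + 1) (deriv c) J := by simpa using h2.2.2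
  rw [contDiffOn_succ_iff_deriv_of_isOpen hJ] at h1
  exact ⟨fun u hu => (h2.1.differentiableAt (hJ.mem_nhds hu)).hasDerivAt,
    fun u hu => (h1.1.differentiableAt (hJ.mem_nhds hu)).hasDerivAt, h1.2.2.continuousOn⟩

theorem exists_reduced_profile {a p : ℝ} (ha0 : a ≠ 0) (ha : a ≠ -1) (hp : p ≠ 0)
    {J : Set ℝ} {c : ℝ → E3} (hJ : IsOpen J) (hJc : IsConnected J) (hc : ContDiffOn ℝ 2 c J)
    (h : ∀ u ∈ J, IsRegularAt (helicalSurface p c) 0 u ∧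
      HasCurvatureRatioAt (helicalSurface p c) a 0 u) :
    ∃ ξ ζ τ ξ' τ' φ φ' : ℝ → ℝ, IsReducedProfile a J ξ ζ τ ξ' τ' ∧
      (∀ u ∈ J, HasDerivAt φ (φ' u) u) ∧ ContinuousOn φ' J ∧
      (∀ u ∈ J, c u = helicalMotion p (φ u) !₂[p * ξ u, p * ζ u, p * τ u]) ∧
      axialParams p c J = {u ∈ J | ξ u = 0} := by
  obtain ⟨hc1, hc2, hc3⟩ := hasDerivAt_of_contDiffOn_two hJ hc
  set x : ℝ → ℝ := fun u => c u 0 with hx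
  set y : ℝ → ℝ := fun u => c u 1 with hy
  set z : ℝ → ℝ := fun u => c u 2 with hz
  set x₁ : ℝ → ℝ := fun u => deriv c u 0 with hx₁
  set y₁ : ℝ → ℝ := fun u => deriv c u 1 with hy₁
  set z₁ : ℝ → ℝ := fun u => deriv c u 2 with hz₁
  set x₂ : ℝ → ℝ := fun u => deriv (deriv c) u 0 with hx₂
  set y₂ : ℝ → ℝ := fun u => deriv (deriv c) u 1 with hy₂
  set z₂ : ℝ → ℝ := fun u => deriv (deriv c) u 2 with hz₂
  have dx : ∀ u ∈ J, HasDerivAt x (x₁ u) u := fun u hu => hasDerivAt_coord (hc1 u hu) 0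
  have dy : ∀ u ∈ J, HasDerivAt y (y₁ u) u := fun u hu => hasDerivAt_coord (hc1 u hu) 1
  have dz : ∀ u ∈ J, HasDerivAt z (z₁ u) u := fun u hu => hasDerivAt_coord (hc1 u hu) 2
  have dx₁ : ∀ u ∈ J, HasDerivAt x₁ (x₂ u) u := fun u hu => hasDerivAt_coord (hc2 u hu) 0
  have dy₁ : ∀ u ∈ J, HasDerivAt y₁ (y₂ u) u := fun u hu => hasDerivAt_coord (hc2 u hu) 1
  have dz₁ : ∀ u ∈ J, HasDerivAt z₁ (z₂ u) u := fun u hu => hasDerivAt_coord (hc2 u hu) 2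
  have cof : ∀ {f f' : ℝ → ℝ}, (∀ u ∈ J, HasDerivAt f (f' u) u) → ContinuousOn f J :=
    fun hf u hu => (hf u hu).continuousAt.continuousWithinAt
  have cx₂ : ContinuousOn x₂ J := (EuclideanSpace.proj 0 : E3 →L[ℝ] ℝ).continuous.comp_continuousOn hc3
  have cy₂ : ContinuousOn y₂ J := (EuclideanSpace.proj 1 : E3 →L[ℝ] ℝ).continuous.comp_continuousOn hc3
  have cz₂ : ContinuousOn z₂ J := (EuclideanSpace.proj 2 : E3 →L[ℝ] ℝ).continuous.comp_continuousOn hc3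
  have cx := cof dx
  have cy := cof dy
  have cx₁ := cof dx₁
  have cy₁ := cof dy₁
  have cz₁ := cof dz₁
  set n₁ : ℝ → ℝ := fun u => x u * z₁ u - p * y₁ u with hn₁
  set n₂ : ℝ → ℝ := fun u => p * x₁ u + y u * z₁ u with hn₂
  set n₁' : ℝ → ℝ := fun u => x₁ u * z₁ u + x u * z₂ u - p * y₂ u with hn₁'
  set n₂' : ℝ → ℝ := fun u => p * x₂ u + (y₁ u * z₁ u + y u * z₂ u) with hn₂'
  have dn₁ : ∀ u ∈ J, HasDerivAt n₁ (n₁' u) u := fun u hu =>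
    ((dx u hu).mul (dz₁ u hu)).sub ((dy₁ u hu).const_mul p)
  have dn₂ : ∀ u ∈ J, HasDerivAt n₂ (n₂' u) u := fun u hu =>
    ((dx₁ u hu).const_mul p).add ((dy u hu).mul (dz₁ u hu))
  have cn₁' : ContinuousOn n₁' J :=
    ((cx₁.mul cz₁).add (cx.mul cz₂)).sub (continuousOn_const.mul cy₂)
  have cn₂' : ContinuousOn n₂' J :=
    (continuousOn_const.mul cx₂).add ((cy₁.mul cz₁).add (cy.mul cz₂))
  have hn : ∀ u ∈ J, n₁ u ^ 2 + n₂ u ^ 2 ≠ 0 := fun u hu =>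
    (isRegularAt_helicalSurface_iff hp (hc1 u hu) 0).1 (h u hu).1
  obtain ⟨φ, dφ, hφ⟩ := exists_polar_angle hJ hJc dn₁ dn₂ cn₁' cn₂' hn
  have cn₁ := cof dn₁
  have cn₂ := cof dn₂
  obtain ⟨φ', hφ'⟩ : ∃ φ' : ℝ → ℝ,
    φ' = fun u => (n₁ u * n₂' u - n₂ u * n₁' u) / (n₁ u ^ 2 + n₂ u ^ 2) := ⟨_, rfl⟩
  have cφ' : ContinuousOn φ' J := by
    rw [hφ']
    exact ((cn₁.mul cn₂').sub (cn₂.mul cn₁')).div ((cn₁.pow 2).add (cn₂.pow 2)) hn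
  replace dφ : ∀ u ∈ J, HasDerivAt φ (φ' u) u := by rwa [hφ']
  clear hφ'
  have cφ := cof dφ
  -- the frame and the curve in it
  set ξ : ℝ → ℝ := fun u => (x u * Real.cos (φ u) + y u * Real.sin (φ u)) / p with hξ
  set ζ : ℝ → ℝ := fun u => (y u * Real.cos (φ u) - x u * Real.sin (φ u)) / p with hζ
  set τ : ℝ → ℝ := fun u => z u / p - φ u with hτ
  set ξ' : ℝ → ℝ := fun u =>
    (x₁ u * Real.cos (φ u) + y₁ u * Real.sin (φ u)) / p + ζ u * φ' u with hξ'
  set τ' : ℝ → ℝ := fun u => z₁ u / p - φ' u with hτ'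
  have hsc : ∀ u, Real.sin (φ u) ^ 2 + Real.cos (φ u) ^ 2 = 1 := fun u => Real.sin_sq_add_cos_sq _
  -- This is the vanishing of the normal component selected by `φ`; it becomes `ζ' = ξ τ'` below.
  have hframe : ∀ u ∈ J, p * (y₁ u * Real.cos (φ u) - x₁ u * Real.sin (φ u)) =
      p * ξ u * z₁ u := by
    intro u hu
    have := hφ u hu
    simp only [hn₁, hn₂] at this
    simp only [hξ]
    field_simp
    linear_combination -this
  have dξ : ∀ u ∈ J, HasDerivAt ξ (ξ' u) u := by
    intro u hu
    refine HasDerivAt.congr_deriv ((((dx u hu).mul (dφ u hu).cos).add ((dy u hu).mul (dφ u hu).sin)).div_const p) ?_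
    simp only [hξ', hζ]
    field_simp
    ring
  have dζ : ∀ u ∈ J, HasDerivAt ζ (ξ u * τ' u) u := by
    intro u hu
    refine HasDerivAt.congr_deriv ((((dy u hu).mul (dφ u hu).cos).sub ((dx u hu).mul (dφ u hu).sin)).div_const p) ?_
    have h1 := hframe u hu
    have h2 : ξ u * φ' u * p = (x u * Real.cos (φ u) + y u * Real.sin (φ u)) * φ' u := by
      simp only [hξ]
      field_simp
    have h3 : y₁ u * Real.cos (φ u) - x₁ u * Real.sin (φ u) = ξ u * z₁ u := by
      apply mul_left_cancel₀ hp
      linear_combination h1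
    simp only [hτ']
    field_simp
    linear_combination h3 + h2
  have dτ : ∀ u ∈ J, HasDerivAt τ (τ' u) u := fun u hu => ((dz u hu).div_const p).sub (dφ u hu)
  have cξ' : ContinuousOn ξ' J := by
    refine ContinuousOn.add (ContinuousOn.div_const (((cx₁.mul ?_)).add (cy₁.mul ?_)) p)
      ((cof dζ).mul cφ')
    · exact Real.continuous_cos.comp_continuousOn cφ
    · exact Real.continuous_sin.comp_continuousOn cφ
  have cτ' : ContinuousOn τ' J := (cz₁.div_const p).sub cφ'
  -- the rotated normal
  set ρ : ℝ → ℝ := fun u => n₂ u * Real.cos (φ u) - n₁ u * Real.sin (φ u) with hρ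
  have hρ₁ : ∀ u ∈ J, n₁ u = -(ρ u * Real.sin (φ u)) := by
    intro u hu
    simp only [hρ]
    linear_combination (-n₁ u) * hsc u + Real.cos (φ u) * hφ u hu
  have hρ₂ : ∀ u ∈ J, n₂ u = ρ u * Real.cos (φ u) := by
    intro u hu
    simp only [hρ]
    linear_combination (-n₂ u) * hsc u + Real.sin (φ u) * hφ u hu
  have hρ0 : ∀ u ∈ J, ρ u ≠ 0 := by
    intro u hu h0
    apply hn u hu
    rw [hρ₁ u hu, hρ₂ u hu, h0]
    simp
  have hpξ : ∀ u, p * ξ u = x u * Real.cos (φ u) + y u * Real.sin (φ u) := by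
    intro u; simp only [hξ]; field_simp
  have hpζ : ∀ u, p * ζ u = y u * Real.cos (φ u) - x u * Real.sin (φ u) := by
    intro u; simp only [hζ]; field_simp
  have ex : ∀ u, x u = p * ξ u * Real.cos (φ u) - p * ζ u * Real.sin (φ u) := by
    intro u; linear_combination (-Real.cos (φ u)) * hpξ u + Real.sin (φ u) * hpζ u - x u * hsc u
  have ey : ∀ u, y u = p * ξ u * Real.sin (φ u) + p * ζ u * Real.cos (φ u) := by
    intro u; linear_combination (-Real.sin (φ u)) * hpξ u - Real.cos (φ u) * hpζ u - y u * hsc u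
  have ez₁ : ∀ u, z₁ u = p * (τ' u + φ' u) := by
    intro u; simp only [hτ']; field_simp; ring
  have ha₁ : ∀ u, x₁ u * Real.cos (φ u) + y₁ u * Real.sin (φ u) = p * (ξ' u - ζ u * φ' u) := by
    intro u; simp only [hξ']; field_simp; ring
  have ha₂ : ∀ u ∈ J, y₁ u * Real.cos (φ u) - x₁ u * Real.sin (φ u) =
      p * (ξ u * (τ' u + φ' u)) := by
    intro u hu
    apply mul_left_cancel₀ hp
    rw [hframe u hu, ez₁ u]; ring
  have ex₁ : ∀ u ∈ J, x₁ u = p * (ξ' u - ζ u * φ' u) * Real.cos (φ u) -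
      p * (ξ u * (τ' u + φ' u)) * Real.sin (φ u) := by
    intro u hu
    linear_combination (Real.cos (φ u)) * ha₁ u - Real.sin (φ u) * ha₂ u hu - x₁ u * hsc u
  have ey₁ : ∀ u ∈ J, y₁ u = p * (ξ' u - ζ u * φ' u) * Real.sin (φ u) +
      p * (ξ u * (τ' u + φ' u)) * Real.cos (φ u) := by
    intro u hu
    linear_combination (Real.sin (φ u)) * ha₁ u + Real.cos (φ u) * ha₂ u hu - y₁ u * hsc u
  have hρe : ∀ u ∈ J, ρ u = p ^ 2 * (ξ' u + ζ u * τ' u) := by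
    intro u hu
    simp only [hρ, hn₁, hn₂]
    rw [ex₁ u hu, ey₁ u hu, ex u, ey u, ez₁ u]
    linear_combination p ^ 2 * (ξ' u + ζ u * τ' u) * hsc u
  have hn₃ : ∀ u ∈ J, -(x u * x₁ u + y u * y₁ u) = -(ρ u * ξ u) := by
    intro u hu
    rw [hρe u hu, ex₁ u hu, ey₁ u hu, ex u, ey u]
    linear_combination (-p ^ 2 * ξ u * (ξ' u + ζ u * τ' u)) * hsc u
  have hcond : ∀ u ∈ J, (1 + ξ u ^ 2) * τ' u - ξ' u * ζ u ≠ 0 ∧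
      -((1 + a) ^ 2 * ((1 + ξ u ^ 2) * ξ' u * (ξ' u + ζ u * τ' u))) =
        a * ((1 + ξ u ^ 2) * τ' u - ξ' u * ζ u) ^ 2 := by
    intro u hu
    have hr := (hasCurvatureRatioAt_helicalSurface_iff (v := 0) ha
      (Filter.eventually_of_mem (hJ.mem_nhds hu) hc1) (hc2 u hu) (h u hu).1
      (hx := rfl) (hy := rfl) (hx₁ := rfl) (hy₁ := rfl) (hz₁ := rfl) (hn₁ := rfl) (hn₂ := rfl)
      (hn₃ := rfl) (hE := rfl) (hF := rfl) (hG := rfl) (hL := rfl) (hM := rfl) (hN := rfl)).1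
      (h u hu).2
    have hρr : ξ' u + ζ u * τ' u ≠ 0 := by
      intro h0; apply hρ0 u hu; rw [hρe u hu, h0, mul_zero]
    refine (ratio_condition_iff_reduced (a := a) hp hρr (hρe u hu) (ψ := φ' u) (ξ := ξ u)
      ?_ ?_ ?_ ?_ ?_ ?_).1 hr
    · change x u ^ 2 + y u ^ 2 + p ^ 2 = _
      rw [ex u, ey u]
      linear_combination (p ^ 2 * (ξ u ^ 2 + ζ u ^ 2)) * hsc u
    · change x u * y₁ u - y u * x₁ u + p * z₁ u = _
      rw [ex u, ey u, ex₁ u hu, ey₁ u hu, ez₁ u]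
      linear_combination (p ^ 2 * (ξ u * (ξ u * (τ' u + φ' u)) - ζ u * (ξ' u - ζ u * φ' u))) * hsc u
    · change x₁ u ^ 2 + y₁ u ^ 2 + z₁ u ^ 2 = _
      rw [ex₁ u hu, ey₁ u hu, ez₁ u]
      linear_combination (p ^ 2 * ((ξ' u - ζ u * φ' u) ^ 2 + (ξ u * (τ' u + φ' u)) ^ 2)) * hsc u
    · change -(n₁ u * x u) - n₂ u * y u = _
      rw [hρ₁ u hu, hρ₂ u hu, ex u, ey u]
      linear_combination (-(ρ u * p * ζ u)) * hsc u
    · change n₂ u * x₁ u - n₁ u * y₁ u = _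
      rw [hρ₁ u hu, hρ₂ u hu, ex₁ u hu, ey₁ u hu]
      linear_combination (ρ u * p * (ξ' u - ζ u * φ' u)) * hsc u
    · change n₁ u * x₂ u + n₂ u * y₂ u + -(x u * x₁ u + y u * y₁ u) * z₂ u = _
      have hev := hJ.eventually_mem hu
      have dρ : HasDerivAt ρ _ u := ((dn₂ u hu).mul (dφ u hu).cos).sub ((dn₁ u hu).mul (dφ u hu).sin)
      generalize hρ' : (n₂' u * Real.cos (φ u) + n₂ u * (-Real.sin (φ u) * φ' u) -
        (n₁' u * Real.sin (φ u) + n₁ u * (Real.cos (φ u) * φ' u))) = ρ' at dρ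
      have e1 := (dn₁ u hu).unique
        ((dρ.mul (dφ u hu).sin).neg.congr_of_eventuallyEq (hev.mono hρ₁))
      have e2 := (dn₂ u hu).unique
        ((dρ.mul (dφ u hu).cos).congr_of_eventuallyEq (hev.mono hρ₂))
      have e3 := (((dx u hu).mul (dx₁ u hu)).add ((dy u hu).mul (dy₁ u hu))).neg.unique
        ((dρ.mul (dξ u hu)).neg.congr_of_eventuallyEq (hev.mono hn₃))
      change n₁' u = -(ρ' * Real.sin (φ u) + ρ u * (Real.cos (φ u) * φ' u)) at e1
      change n₂' u = ρ' * Real.cos (φ u) + ρ u * (-Real.sin (φ u) * φ' u) at e2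
      change -(x₁ u * x₁ u + x u * x₂ u + (y₁ u * y₁ u + y u * y₂ u)) =
        -(ρ' * ξ u + ρ u * ξ' u) at e3
      -- This is `n · c'' = -n' · c'`, the derivative of `n · c' = 0`. With `n = ρ (-sin φ, cos φ,
      -- -ξ)` the unknown `ρ'` multiplies a vector orthogonal to `c'`, so it drops out and no second
      -- derivative remains.
      have e0 : n₁ u * x₂ u + n₂ u * y₂ u + -(x u * x₁ u + y u * y₁ u) * z₂ u =
          -(n₁' u * x₁ u + n₂' u * y₁ u -
            (x₁ u * x₁ u + x u * x₂ u + (y₁ u * y₁ u + y u * y₂ u)) * z₁ u) := by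
        simp only [hn₁, hn₂, hn₁', hn₂']
        ring
      rw [e0]
      have ez := ez₁ u
      linear_combination (-x₁ u) * e1 - y₁ u * e2 - z₁ u * e3 + ρ u * φ' u * ha₁ u -
        ρ' * ha₂ u hu + (ρ' * ξ u + ρ u * ξ' u) * ez
  have hax : axialParams p c J = {u ∈ J | ξ u = 0} := by
    ext u
    refine and_congr_right fun hu => ?_
    rw [mem_tangentPlane_axis_iff hp (hc1 u hu) (h u hu).1, ← neg_eq_zero]
    change -(x u * x₁ u + y u * y₁ u) = 0 ↔ _
    rw [hn₃ u hu]
    simp [hρ0 u hu]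
  have hce : ∀ u ∈ J, c u = helicalMotion p (φ u) !₂[p * ξ u, p * ζ u, p * τ u] := by
    intro u _
    ext i
    fin_cases i
    · simpa [helicalMotion] using ex u
    · simpa [helicalMotion] using ey u
    · simp only [helicalMotion, hτ]
      simp
      field_simp
      simp [hz]
  -- If `ξ'` vanished, the left side of the ratio equation would be zero, and `a ≠ 0` would kill the
  -- mean curvature factor, which is nonzero.
  have hξ'0 : ∀ u ∈ J, ξ' u ≠ 0 := by
    intro u hu h0
    obtain ⟨h1, h2⟩ := hcond u hu
    rw [h0] at h1 h2
    have : a * ((1 + ξ u ^ 2) * τ' u - 0 * ζ u) ^ 2 = 0 := by rw [← h2]; ring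
    simp [ha0] at this
    simp [this] at h1
  set P : ℝ → ℝ := fun u => ((1 + ξ u ^ 2) * τ' u - ξ' u * ζ u) * ξ' u with hP
  have hP0 : ∀ u ∈ J, P u ≠ 0 := fun u hu => mul_ne_zero (hcond u hu).1 (hξ'0 u hu)
  have hPc : ContinuousOn P J :=
    (((continuousOn_const.add ((cof dξ).pow 2)).mul cτ').sub (cξ'.mul (cof dζ))).mul cξ'
  obtain hs | hs : (∀ u ∈ J, 0 < P u) ∨ ∀ u ∈ J, P u < 0 := by
    by_contra! hcon
    obtain ⟨⟨u, hu, hu'⟩, w, hw, hw'⟩ := hcon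
    obtain ⟨t, ht, ht'⟩ := hJc.isPreconnected.intermediate_value hu hw hPc ⟨hu', hw'⟩
    exact hP0 t ht ht'
  · exact ⟨ξ, ζ, τ, ξ', τ', φ, φ', ⟨dξ, dζ, dτ, cξ', cτ', fun u hu => (hcond u hu).2, hs⟩,
      dφ, cφ', hce, hax⟩
  -- Turning the frame by `π` reverses the sign of `P`; the shift of `τ` by `-π` compensates the
  -- pitch.
  · refine ⟨fun u => -ξ u, fun u => -ζ u, fun u => τ u - Real.pi, fun u => -ξ' u, τ',
      fun u => φ u + Real.pi, φ', ⟨fun u hu => (dξ u hu).neg, fun u hu => ?_,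
      fun u hu => (dτ u hu).sub_const _, cξ'.neg, cτ', fun u hu => ?_, fun u hu => ?_⟩,
      fun u hu => (dφ u hu).add_const _, cφ', fun u hu => ?_, ?_⟩
    · refine HasDerivAt.congr_deriv ((dζ u hu).neg) ?_
      ring
    · linear_combination (hcond u hu).2
    · have := hs u hu
      simp only [hP] at this
      linarith
    · rw [hce u hu]
      ext i
      fin_cases i <;> simp [helicalMotion] <;> ring
    · simp only [neg_eq_zero]
      exact hax

/-! ### The conic and its rational parameter -/

theorem ratioParam_pos {a : ℝ} (ha1 : a ≠ 1) (ham1 : a ≠ -1) : 0 < ratioParam a :=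
  abs_pos.2 (div_ne_zero (sub_ne_zero.2 ha1) fun h => ham1 (by linarith))

theorem ratioParam_sq {a : ℝ} (ham1 : a ≠ -1) :
    (1 - ratioParam a ^ 2) * (1 + a) ^ 2 = 4 * a := by
  have h : a + 1 ≠ 0 := fun h => ham1 (by linarith)
  rw [ratioParam, sq_abs]
  field_simp
  ring

/-- The rational parametrization by `s` of the branch `δ > 0` of the conic
`(k² - 1) δ² = 4 (1 + η δ + η²)`. -/
theorem conic_parametrization {k δ η s : ℝ} (hk : 0 < k) (hδ : 0 < δ)
    (h : (k ^ 2 - 1) * δ ^ 2 = 4 * (1 + η * δ + η ^ 2)) (hs : s = ((k + 1) * δ + 2 * η) / 2) :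
    0 < s ∧ k * δ * s = s ^ 2 + 1 ∧ 2 * k * s * η = (k - 1) * s ^ 2 - (k + 1) := by
  -- The conic is a hyperbola in asymptote coordinates `s` and `k δ - s`; since their sum is
  -- positive on this branch, both are positive.
  have h1 : s * (k * δ - s) = 1 := by rw [hs]; linear_combination h / 4
  have hkδ := mul_pos hk hδ
  have h2 : 0 < s := by
    by_contra! hn
    nlinarith
  have h3 : k * δ * s = s ^ 2 + 1 := by linear_combination h1
  refine ⟨h2, h3, ?_⟩
  have h4 : 2 * η = 2 * s - (k + 1) * δ := by rw [hs]; ring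
  linear_combination k * s * h4 - (k + 1) * h3

/-- The ratio `g / (√h / 2)` as a function of `s`. -/
def slopeFun (k s : ℝ) : ℝ := ((k - 1) * s - (k + 1) / s) / (2 * k)

theorem hasStrictDerivAt_slopeFun (k : ℝ) {s : ℝ} (hs : s ≠ 0) :
    HasStrictDerivAt (slopeFun k) (((k - 1) * s ^ 2 + (k + 1)) / (2 * k * s ^ 2)) s := by
  have h := (((hasStrictDerivAt_id s).const_mul (k - 1)).sub
    ((hasStrictDerivAt_inv hs).const_mul (k + 1))).div_const (2 * k)
  refine (HasStrictDerivAt.congr_deriv h ?_).congr_of_eventuallyEq (Filter.Eventually.of_forall ?_)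
  · by_cases hk : k = 0
    · simp [hk]
    · field_simp
      ring
  · intro x
    simp [slopeFun, div_eq_mul_inv]

/-- A critical point of `slopeFun` on the positive axis is a maximum. -/
theorem slopeFun_le_of_critical {k s t : ℝ} (hk : 0 < k) (_hs : 0 < s) (ht : 0 < t)
    (h : (k - 1) * s ^ 2 + (k + 1) = 0) : slopeFun k t ≤ slopeFun k s := by
  -- Criticality gives `k + 1 = (1 - k) s²`, which turns the difference into a multiple of a square
  -- and forces `k < 1`.
  have h1 : slopeFun k s - slopeFun k t = (1 - k) * (t - s) ^ 2 / (2 * k * t) := by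
    have : k + 1 = (1 - k) * s ^ 2 := by linarith
    rw [slopeFun, slopeFun, this]
    field_simp
    ring
  have h2 : 0 < 1 - k := by
    by_contra! hn
    nlinarith [sq_nonneg s]
  have : 0 ≤ (1 - k) * (t - s) ^ 2 / (2 * k * t) := by positivity
  linarith

/-- Differentiability of a continuous function defined implicitly by `f (s u) = η u`. -/
theorem hasDerivAt_of_comp {f s η : ℝ → ℝ} {f' η' u : ℝ} (hf : HasStrictDerivAt f f' (s u))
    (hf' : f' ≠ 0) (hs : ContinuousAt s u) (hη : HasDerivAt η η' u)
    (h : ∀ᶠ x in nhds u, f (s x) = η x) : HasDerivAt s (η' / f') u := by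
  set g := hf.localInverse f f' (s u) hf' with hg
  have h1 : ∀ᶠ x in nhds u, g (f (s x)) = s x :=
    hs.eventually (hf.hasStrictFDerivAt_equiv hf').eventually_left_inverse
  have h2 : HasDerivAt g f'⁻¹ (η u) := by
    rw [← h.self_of_nhds]
    exact (hf.to_localInverse hf').hasDerivAt
  have h3 := h2.comp u hη
  rw [inv_mul_eq_div] at h3
  refine h3.congr_of_eventuallyEq ?_
  filter_upwards [h, h1] with x hx hx1
  rw [Function.comp, ← hx, hx1]

/-- A continuous function on an interval whose derivative vanishes off the zero of an injective
function is constant. -/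
theorem eq_of_hasDerivAt_zero_off {J : Set ℝ} (hJ : J.OrdConnected) {f ξ : ℝ → ℝ}
    (hf : ContinuousOn f J) (hξ : Set.InjOn ξ J)
    (hd : ∀ u ∈ J, ξ u ≠ 0 → HasDerivAt f 0 u) {x y : ℝ} (hx : x ∈ J) (hy : y ∈ J) :
    f x = f y := by
  have key : ∀ x ∈ J, ∀ y ∈ J, x < y → (∀ t ∈ Set.Ioo x y, ξ t ≠ 0) → f x = f y := by
    intro x hx y hy hxy h0
    have hsub := hJ.out hx hy
    obtain ⟨t, -, ht⟩ := exists_hasDerivAt_eq_slope f (fun _ => 0) hxy (hf.mono hsub)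
      fun t ht => hd t (hsub (Set.Ioo_subset_Icc_self ht)) (h0 t ht)
    have := sub_ne_zero.2 hxy.ne'
    field_simp at ht
    linarith
  have key2 : ∀ x ∈ J, ∀ y ∈ J, x < y → f x = f y := by
    intro x hx y hy hxy
    by_cases h0 : ∃ t ∈ Set.Ioo x y, ξ t = 0
    · obtain ⟨t, ht, ht0⟩ := h0
      have htJ := hJ.out hx hy (Set.Ioo_subset_Icc_self ht)
      have hz : ∀ w ∈ J, w ≠ t → ξ w ≠ 0 := fun w hw hwt h =>
        hwt (hξ hw htJ (h.trans ht0.symm))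
      rw [key x hx t htJ ht.1 fun w hw => hz w (hJ.out hx htJ (Set.Ioo_subset_Icc_self hw)) hw.2.ne,
        key t htJ y hy ht.2 fun w hw => hz w (hJ.out htJ hy (Set.Ioo_subset_Icc_self hw)) hw.1.ne']
    · push Not at h0
      exact key x hx y hy hxy h0
  rcases lt_trichotomy x y with h | h | h
  · exact key2 x hx y hy h
  · rw [h]
  · exact (key2 y hy x hx h).symm

/-! ### Integration of the reduced equation -/

theorem IsReducedProfile.deriv_fst_ne_zero {a : ℝ} {J : Set ℝ} {ξ ζ τ ξ' τ' : ℝ → ℝ}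
    (h : IsReducedProfile a J ξ ζ τ ξ' τ') {u : ℝ} (hu : u ∈ J) : ξ' u ≠ 0 :=
  right_ne_zero_of_mul (h.pos u hu).ne'

/-- Rolle's theorem with `ξ' ≠ 0`. Injectivity gives uniqueness of the axial helix and makes each
sign part of `ξ` an interval. -/
theorem IsReducedProfile.injOn {a : ℝ} {J : Set ℝ} {ξ ζ τ ξ' τ' : ℝ → ℝ}
    (h : IsReducedProfile a J ξ ζ τ ξ' τ') (hJ : J.OrdConnected) : Set.InjOn ξ J := by
  have key : ∀ x ∈ J, ∀ y ∈ J, x < y → ξ x ≠ ξ y := by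
    intro x hx y hy hxy heq
    have hsub := hJ.out hx hy
    obtain ⟨t, ht, ht0⟩ := exists_hasDerivAt_eq_zero hxy
      (fun t ht => (h.hasDerivAt_fst t (hsub ht)).continuousAt.continuousWithinAt) heq
      fun t ht => h.hasDerivAt_fst t (hsub (Set.Ioo_subset_Icc_self ht))
    exact h.deriv_fst_ne_zero (hsub (Set.Ioo_subset_Icc_self ht)) ht0
  intro x hx y hy heq
  by_contra hne
  rcases lt_or_gt_of_ne hne with hlt | hlt
  · exact key x hx y hy hlt heq
  · exact key y hy x hx hlt heq.symm

/-- On the conic, `η` is a function of `s` alone, and its evolution has a first integral, whose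
value is `C`. The parameter is continuous on all of `J`, but its differentiability is claimed only
where `ξ ≠ 0`. -/
theorem IsReducedProfile.exists_parameter {a : ℝ} (ha1 : a ≠ 1) (ham1 : a ≠ -1)
    {J : Set ℝ} (hJ : IsOpen J) (hJc : IsConnected J) {ξ ζ τ ξ' τ' : ℝ → ℝ}
    (h : IsReducedProfile a J ξ ζ τ ξ' τ') :
    ∃ C : ℝ, 0 < C ∧ ∃ s s' : ℝ → ℝ, ContinuousOn s J ∧
      (∀ u ∈ J, 0 < s u ∧ hFun (ratioParam a) C (s u) = 1 + ξ u ^ 2 ∧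
        2 * gFun (ratioParam a) C (s u) = ζ u) ∧
      (∀ u ∈ J, ξ u ≠ 0 → HasDerivAt s (s' u) u ∧ s' u ≠ 0) ∧
      ContinuousOn s' {u ∈ J | ξ u ≠ 0} := by
  have hk := ratioParam_pos ha1 ham1
  have hka := ratioParam_sq ham1
  set k := ratioParam a with hkdef
  have hord : J.OrdConnected := hJc.isPreconnected.ordConnected
  have cξ : ContinuousOn ξ J := fun u hu =>
    (h.hasDerivAt_fst u hu).continuousAt.continuousWithinAt
  have cζ : ContinuousOn ζ J := fun u hu =>
    (h.hasDerivAt_snd u hu).continuousAt.continuousWithinAt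
  set ω : ℝ → ℝ := fun u => Real.sqrt (1 + ξ u ^ 2) with hω
  have hωpos : ∀ u, 0 < ω u := fun u => Real.sqrt_pos.2 (by positivity)
  have hωsq : ∀ u, ω u ^ 2 = 1 + ξ u ^ 2 := fun u => Real.sq_sqrt (by positivity)
  have cω : ContinuousOn ω J := (continuousOn_const.add (cξ.pow 2)).sqrt
  set η : ℝ → ℝ := fun u => ζ u / ω u with hη
  set δ : ℝ → ℝ := fun u => ((1 + ξ u ^ 2) * τ' u - ξ' u * ζ u) / (ξ' u * ω u) with hδ
  set s : ℝ → ℝ := fun u => ((k + 1) * δ u + 2 * η u) / 2 with hs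
  have cη : ContinuousOn η J := cζ.div cω fun u _ => (hωpos u).ne'
  have cδ : ContinuousOn δ J :=
    (((continuousOn_const.add (cξ.pow 2)).mul h.continuousOn_height).sub
      (h.continuousOn_fst.mul cζ)).div (h.continuousOn_fst.mul cω)
      fun u hu => mul_ne_zero (h.deriv_fst_ne_zero hu) (hωpos u).ne'
  have cs : ContinuousOn s J := ((continuousOn_const.mul cδ).add (continuousOn_const.mul cη)).div_const 2
  have hδpos : ∀ u ∈ J, 0 < δ u := by
    intro u hu
    have h0 := h.deriv_fst_ne_zero hu
    have h1 := h.pos u hu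
    have : δ u = (((1 + ξ u ^ 2) * τ' u - ξ' u * ζ u) * ξ' u) / (ξ' u ^ 2 * ω u) := by
      simp only [hδ]; field_simp
    rw [this]
    have := hωpos u
    positivity
  have hspec : ∀ u ∈ J, 0 < s u ∧ k * δ u * s u = s u ^ 2 + 1 ∧
      2 * k * s u * η u = (k - 1) * s u ^ 2 - (k + 1) := by
    intro u hu
    refine conic_parametrization hk (hδpos u hu) ?_ rfl
    have h0 := h.deriv_fst_ne_zero hu
    have hw := (hωpos u).ne'
    have h1a : (1 + a) ^ 2 ≠ 0 := pow_ne_zero 2 fun h => ham1 (by linarith)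
    have h2 : (1 - k ^ 2) * ((1 + ξ u ^ 2) * τ' u - ξ' u * ζ u) ^ 2 =
        -4 * ((1 + ξ u ^ 2) * ξ' u * (ξ' u + ζ u * τ' u)) := by
      apply mul_left_cancel₀ h1a
      linear_combination ((1 + ξ u ^ 2) * τ' u - ξ' u * ζ u) ^ 2 * hka - 4 * h.ratio u hu
    simp only [hδ, hη, ← hωsq u] at h2 ⊢
    field_simp
    linear_combination (-1) * h2
  have hslope : ∀ u ∈ J, slopeFun k (s u) = η u := by
    intro u hu
    obtain ⟨h1, -, h3⟩ := hspec u hu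
    rw [slopeFun]
    field_simp
    linear_combination -h3
  have dω : ∀ u ∈ J, HasDerivAt ω (ξ u * ξ' u / ω u) u := by
    intro u hu
    have h1 : (1 + ξ u ^ 2) ≠ 0 := by positivity
    have := (((h.hasDerivAt_fst u hu).pow 2).const_add 1).sqrt h1
    refine HasDerivAt.congr_deriv this ?_
    have := (hωpos u).ne'
    simp only [hω] at this ⊢
    simp
    field_simp
  have dη : ∀ u ∈ J, HasDerivAt η (ξ u * ξ' u * δ u / ω u ^ 2) u := by
    intro u hu
    refine ((h.hasDerivAt_snd u hu).div (dω u hu) (hωpos u).ne').congr_deriv ?_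
    have h0 := h.deriv_fst_ne_zero hu
    have hw := (hωpos u).ne'
    simp only [hδ, ← hωsq u]
    field_simp
  -- A critical value of `slopeFun` is its maximum, so `η` would have a local maximum at `u`,
  -- contrary to `η' = ξ ξ' δ / ω² ≠ 0`.
  have hcrit : ∀ u ∈ J, ξ u ≠ 0 → (k - 1) * s u ^ 2 + (k + 1) ≠ 0 := by
    intro u hu hξu hc
    have hmax : IsLocalMax η u := by
      filter_upwards [hJ.mem_nhds hu] with t ht
      rw [← hslope u hu, ← hslope t ht]
      exact slopeFun_le_of_critical hk (hspec u hu).1 (hspec t ht).1 hc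
    have h0 := hmax.hasDerivAt_eq_zero (dη u hu)
    have := (hωpos u).ne'
    have h1 := h.deriv_fst_ne_zero hu
    have h2 := (hδpos u hu).ne'
    simp_all
  set s' : ℝ → ℝ := fun u => (ξ u * ξ' u * δ u / ω u ^ 2) /
    (((k - 1) * s u ^ 2 + (k + 1)) / (2 * k * s u ^ 2)) with hs'
  have ds : ∀ u ∈ J, ξ u ≠ 0 → HasDerivAt s (s' u) u := by
    intro u hu hξu
    have hsu := (hspec u hu).1
    refine hasDerivAt_of_comp (hasStrictDerivAt_slopeFun k hsu.ne')
      (div_ne_zero (hcrit u hu hξu) (by positivity)) (cs.continuousAt (hJ.mem_nhds hu)) (dη u hu) ?_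
    filter_upwards [hJ.mem_nhds hu] with t ht using hslope t ht
  -- Substituting `δ = (s² + 1) / (k s)` into the equation for `η'` equates the logarithmic
  -- derivatives of `ω²` and of `s ^ (k + 1) / (s² + 1)`; `K` is half the quotient of these.
  set K : ℝ → ℝ := fun u => ω u ^ 2 * (s u ^ 2 + 1) / (2 * s u ^ (k + 1)) with hK
  have cK : ContinuousOn K J := by
    refine ((cω.pow 2).mul ((cs.pow 2).add continuousOn_const)).div
      (continuousOn_const.mul (cs.rpow_const fun u hu => Or.inl (hspec u hu).1.ne')) fun u hu => ?_
    have := Real.rpow_pos_of_pos (hspec u hu).1 (k + 1)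
    positivity
  have dK : ∀ u ∈ J, ξ u ≠ 0 → HasDerivAt K 0 u := by
    intro u hu hξu
    obtain ⟨hsu, h2, -⟩ := hspec u hu
    have hr := Real.rpow_pos_of_pos hsu (k + 1)
    have hc := hcrit u hu hξu
    have hw := hωpos u
    have d1 := ds u hu hξu
    refine ((((dω u hu).pow 2).mul ((d1.pow 2).add_const 1)).div
      ((d1.rpow_const (p := k + 1) (Or.inl hsu.ne')).const_mul 2) (by positivity)).congr_deriv ?_
    rw [add_sub_cancel_right, Real.rpow_add_one hsu.ne' k]
    have hr' := Real.rpow_pos_of_pos hsu k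
    have h3 : δ u = (s u ^ 2 + 1) / (k * s u) := by field_simp; linear_combination h2
    simp only [hs', Pi.pow_apply]
    rw [h3]
    obtain ⟨q, hq⟩ : ∃ q, q = (k - 1) * s u ^ 2 + (k + 1) := ⟨_, rfl⟩
    rw [← hq] at hc ⊢
    norm_num
    field_simp
    subst hq
    exact Or.inl (by ring)
  obtain ⟨u₀, hu₀⟩ := hJc.nonempty
  -- Continuity of `K` across the possible zero of `ξ` makes one constant `C` serve both sides.
  have hKc : ∀ u ∈ J, K u = K u₀ := fun u hu =>
    eq_of_hasDerivAt_zero_off hord cK (h.injOn hord) dK hu hu₀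
  have hh : ∀ u ∈ J, hFun k (K u₀) (s u) = 1 + ξ u ^ 2 := by
    intro u hu
    have hsu := (hspec u hu).1
    have hr := Real.rpow_pos_of_pos hsu (k + 1)
    rw [← hKc u hu, ← hωsq u, hFun]
    simp only [hK]
    field_simp
  refine ⟨K u₀, ?_, s, s', cs, fun u hu => ⟨(hspec u hu).1, hh u hu, ?_⟩, fun u hu hξu =>
    ⟨ds u hu hξu, ?_⟩, ?_⟩
  · have hsu := (hspec u₀ hu₀).1
    have hr := Real.rpow_pos_of_pos hsu (k + 1)
    have hw := hωpos u₀
    simp only [hK]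
    positivity
  · obtain ⟨hsu, -, h3⟩ := hspec u hu
    rw [gFun, hh u hu, ← h3]
    have hw := (hωpos u).ne'
    change 2 * (2 * k * s u * (ζ u / ω u) / (4 * k * s u) * ω u) = ζ u
    field_simp
    ring
  · have hsu := (hspec u hu).1
    have hc := hcrit u hu hξu
    have hw := (hωpos u).ne'
    have h1 := h.deriv_fst_ne_zero hu
    have h2 := (hδpos u hu).ne'
    simp only [hs']
    positivity
  · have hsub : {u ∈ J | ξ u ≠ 0} ⊆ J := fun u hu => hu.1
    refine ContinuousOn.div ((((cξ.mul h.continuousOn_fst).mul cδ).div (cω.pow 2) ?_).mono hsub)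
      ((((continuousOn_const.mul (cs.pow 2)).add continuousOn_const).div
        (continuousOn_const.mul (cs.pow 2)) ?_).mono hsub) ?_
    · intro u _
      exact pow_ne_zero 2 (hωpos u).ne'
    · intro u hu
      have := (hspec u hu).1
      change 2 * k * s u ^ 2 ≠ 0
      positivity
    · intro u hu
      have := (hspec u hu.1).1
      exact div_ne_zero (hcrit u hu.1 hu.2) (by positivity)

/-! ### The functions `h`, `g`, `t` and the interval `I_C` -/

theorem hFun_pos {k C s : ℝ} (hC : 0 < C) (hs : 0 < s) : 0 < hFun k C s := by
  have := Real.rpow_pos_of_pos hs (k + 1)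
  unfold hFun
  positivity

theorem hasDerivAt_hFun (k C : ℝ) {s : ℝ} (hs : 0 < s) :
    HasDerivAt (hFun k C)
      (hFun k C s * ((k - 1) * s ^ 2 + (k + 1)) / (s * (s ^ 2 + 1))) s := by
  have h := ((((hasDerivAt_id s).rpow_const (p := k + 1) (Or.inl hs.ne')).const_mul (2 * C))).div
    (((hasDerivAt_id s).pow 2).add_const 1) (by change s ^ 2 + 1 ≠ 0; positivity)
  refine HasDerivAt.congr_deriv h ?_
  rw [hFun, add_sub_cancel_right, Real.rpow_add_one hs.ne' k]
  simp
  rw [Real.rpow_add_one hs.ne' k]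
  field_simp
  ring

theorem contDiffOn_hFun (k C : ℝ) (n : ℕ∞) : ContDiffOn ℝ n (hFun k C) (Set.Ioi 0) := by
  refine ContDiffOn.div (contDiffOn_const.mul
    (contDiffOn_id.rpow_const_of_ne fun s hs => ne_of_gt hs))
    ((contDiffOn_id.pow 2).add contDiffOn_const) fun s _ => ?_
  change s ^ 2 + 1 ≠ 0
  positivity

theorem isOpen_domainI (k C : ℝ) : IsOpen (domainI k C) :=
  (contDiffOn_hFun k C 0).continuousOn.isOpen_inter_preimage isOpen_Ioi isOpen_Ioi

theorem domainI_subset (k C : ℝ) : domainI k C ⊆ Set.Ioi 0 := fun _ hs => hs.1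

/-- The condition reads `s ^ (1 - k) + s ^ (-1 - k) < 2 C`, a sublevel set of a convex function of
`log s`. This is why `I_C` is an interval, over which antiderivatives can be taken by integration
from one base point. -/
theorem one_lt_hFun_iff {k C s : ℝ} (hs : 0 < s) : 1 < hFun k C s ↔
    Real.exp ((1 - k) * Real.log s) + Real.exp (-(1 + k) * Real.log s) < 2 * C := by
  have hr := Real.rpow_pos_of_pos hs (k + 1)
  have h1 : Real.exp ((1 - k) * Real.log s) = s ^ 2 / s ^ (k + 1) := by
    rw [← Real.rpow_natCast, ← Real.rpow_sub hs, Real.rpow_def_of_pos hs]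
    congr 1
    push_cast
    ring
  have h2 : Real.exp (-(1 + k) * Real.log s) = 1 / s ^ (k + 1) := by
    rw [one_div, ← Real.rpow_neg hs.le, Real.rpow_def_of_pos hs]
    congr 1
    ring
  rw [h1, h2, ← add_div, div_lt_iff₀ hr, hFun, one_lt_div (by positivity)]

theorem convexOn_exp_mul (b : ℝ) : ConvexOn ℝ Set.univ fun x : ℝ => Real.exp (b * x) :=
  convexOn_exp.comp_linearMap (LinearMap.mulLeft ℝ b)

theorem ordConnected_domainI (k C : ℝ) : (domainI k C).OrdConnected := by
  refine ⟨fun x hx y hy z hz => ?_⟩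
  have hz0 : 0 < z := hx.1.trans_le hz.1
  refine ⟨hz0, (one_lt_hFun_iff hz0).2 ?_⟩
  have hconv := (((convexOn_exp_mul (1 - k)).add (convexOn_exp_mul (-(1 + k)))).convex_lt
    (2 * C)).ordConnected
  exact (hconv.out (x := Real.log x) (y := Real.log y)
    ⟨trivial, (one_lt_hFun_iff hx.1).1 hx.2⟩ ⟨trivial, (one_lt_hFun_iff hy.1).1 hy.2⟩
    ⟨Real.log_le_log hx.1 hz.1, Real.log_le_log hz0 hz.2⟩).2

/-- The factor `(k - 1) s² + (k + 1)` is shared with the derivative of `t`; its zero is the excluded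
parameter of the converse. -/
theorem hasDerivAt_gFun {k C s : ℝ} (hk : k ≠ 0) (hC : 0 < C) (hs : 0 < s) :
    HasDerivAt (gFun k C) (((k - 1) * s ^ 2 + (k + 1)) * ((k + 1) * s ^ 2 - (k - 1)) *
      Real.sqrt (hFun k C s) / (8 * k * s ^ 2 * (s ^ 2 + 1))) s := by
  have hh := hFun_pos (k := k) hC hs
  have h := (((((hasDerivAt_id s).pow 2).const_mul (k - 1)).sub_const (k + 1)).div
    ((hasDerivAt_id s).const_mul (4 * k)) (by simp [hk, hs.ne'])).mul
    ((hasDerivAt_hFun k C hs).sqrt hh.ne')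
  refine HasDerivAt.congr_deriv h ?_
  have hr := Real.sqrt_pos.2 hh
  have hr2 := Real.sq_sqrt hh.le
  generalize Real.sqrt (hFun k C s) = r at hr hr2 ⊢
  rw [← hr2]
  simp
  field_simp
  ring

theorem contDiffOn_gFun {k C : ℝ} (hk : k ≠ 0) (hC : 0 < C) (n : ℕ∞) :
    ContDiffOn ℝ n (gFun k C) (Set.Ioi 0) := by
  refine ContDiffOn.mul (ContDiffOn.div
    ((contDiffOn_const.mul (contDiffOn_id.pow 2)).sub contDiffOn_const)
    (contDiffOn_const.mul contDiffOn_id) fun s hs => ?_)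
    ((contDiffOn_hFun k C n).sqrt fun s hs => (hFun_pos hC hs).ne')
  exact mul_ne_zero (mul_ne_zero four_ne_zero hk) (ne_of_gt hs)

theorem contDiffOn_tFun (k C : ℝ) (n : ℕ∞) : ContDiffOn ℝ n (tFun k C) (domainI k C) :=
  (((contDiffOn_hFun k C n).mono (domainI_subset k C)).sub contDiffOn_const).sqrt
    fun _ hs => (sub_pos.2 hs.2).ne'

theorem tFun_pos {k C s : ℝ} (hs : s ∈ domainI k C) : 0 < tFun k C s :=
  Real.sqrt_pos.2 (sub_pos.2 hs.2)

theorem tFun_sq {k C s : ℝ} (hs : s ∈ domainI k C) : tFun k C s ^ 2 = hFun k C s - 1 :=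
  Real.sq_sqrt (sub_pos.2 hs.2).le

theorem hasDerivAt_tFun {k C s : ℝ} (hs : s ∈ domainI k C) :
    HasDerivAt (tFun k C) (hFun k C s * ((k - 1) * s ^ 2 + (k + 1)) / (s * (s ^ 2 + 1)) /
      (2 * tFun k C s)) s :=
  ((hasDerivAt_hFun k C hs.1).sub_const 1).sqrt (sub_pos.2 hs.2).ne'

theorem contDiffOn_height_deriv {k C : ℝ} (hk : k ≠ 0) (hC : 0 < C) (n : ℕ∞) :
    ContDiffOn ℝ n (fun s => deriv (gFun k C) s / tFun k C s) (domainI k C) := by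
  have h : ContDiffOn ℝ ((n + 1 : ℕ∞) : WithTop ℕ∞) (gFun k C) (domainI k C) :=
    (contDiffOn_gFun hk hC (n + 1)).mono (domainI_subset k C)
  exact (h.deriv_of_isOpen (isOpen_domainI k C) (by simp)).div (contDiffOn_tFun k C n)
    fun s hs => (tFun_pos hs).ne'

theorem exists_isHeight {k C : ℝ} (hk : k ≠ 0) (hC : 0 < C) : ∃ Z : ℝ → ℝ, IsHeight k C Z := by
  have hc := (contDiffOn_height_deriv hk hC 0).continuousOn
  have hO := isOpen_domainI k C
  rcases (domainI k C).eq_empty_or_nonempty with he | ⟨s₀, hs₀⟩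
  · exact ⟨0, fun s hs => by simp [he] at hs⟩
  · refine ⟨fun s => ∫ x in s₀..s, deriv (gFun k C) x / tFun k C x, fun s hs => ?_⟩
    have hsub := (ordConnected_domainI k C).uIcc_subset hs₀ hs
    exact intervalIntegral.integral_hasDerivAt_right ((hc.mono hsub).intervalIntegrable)
      (hc.stronglyMeasurableAtFilter hO s hs) (hc.continuousAt (hO.mem_nhds hs))

theorem IsHeight.add_const {k C : ℝ} {Z : ℝ → ℝ} (hZ : IsHeight k C Z) (b : ℝ) :
    IsHeight k C fun s => Z s + b := fun s hs => (hZ s hs).add_const b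

/-! ### The explicit surfaces have the prescribed ratio -/

/-- Sign `1` for the curve `X₀` and `-1` for `X₁`. -/
def profileSign (i : Fin 2) : ℝ := if i = 0 then 1 else -1

theorem profileSign_sq (i : Fin 2) : profileSign i ^ 2 = 1 := by
  fin_cases i <;> simp [profileSign]

theorem profileSign_ne_zero (i : Fin 2) : profileSign i ≠ 0 := by
  fin_cases i <;> simp [profileSign]

theorem profileCurve_eq (k C : ℝ) (Z : ℝ → ℝ) (i : Fin 2) (s : ℝ) :
    profileCurve k C Z i s =
      !₂[profileSign i * tFun k C s / 2, gFun k C s, profileSign i * Z s] := by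
  fin_cases i
  · simp [profileCurve, profileSign]
  · simp [profileCurve, profileSign]
    ring

/-- Scaling by `2 p` turns pitch `1/2` into pitch `p`, and the profile takes the reduced form with
`ξ = ±t`, `ζ = 2 g`, `τ = ±2 Z`. -/
theorem explicitSurface_eq (p k C : ℝ) (Z : ℝ → ℝ) (i : Fin 2) :
    explicitSurface p k C Z i = helicalSurface p fun s => !₂[p * (profileSign i * tFun k C s),
      p * (2 * gFun k C s), p * (2 * (profileSign i * Z s))] := by
  funext v s
  rw [explicitSurface, helicalSurface, profileCurve_eq]
  ext j
  fin_cases j <;> simp [helicalMotion] <;> ring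

/-- Regularity and the ratio condition for a helical surface whose normals along the profile curve
are orthogonal to the first coordinate axis. -/
theorem isRegularAt_and_hasCurvatureRatioAt_of_reduced {a p : ℝ} (ha : a ≠ -1) (hp : p ≠ 0)
    {ξ ζ τ ξ' τ' : ℝ → ℝ} {u ξ'' τ'' : ℝ}
    (hξ : ∀ᶠ y in nhds u, HasDerivAt ξ (ξ' y) y)
    (hζ : ∀ᶠ y in nhds u, HasDerivAt ζ (ξ y * τ' y) y)
    (hτ : ∀ᶠ y in nhds u, HasDerivAt τ (τ' y) y)
    (hξ' : HasDerivAt ξ' ξ'' u) (hτ' : HasDerivAt τ' τ'' u)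
    (hreg : ξ' u + ζ u * τ' u ≠ 0) (hne : (1 + ξ u ^ 2) * τ' u - ξ' u * ζ u ≠ 0)
    (hratio : -((1 + a) ^ 2 * ((1 + ξ u ^ 2) * ξ' u * (ξ' u + ζ u * τ' u))) =
      a * ((1 + ξ u ^ 2) * τ' u - ξ' u * ζ u) ^ 2) (v : ℝ) :
    IsRegularAt (helicalSurface p fun y => !₂[p * ξ y, p * ζ y, p * τ y]) v u ∧
      HasCurvatureRatioAt (helicalSurface p fun y => !₂[p * ξ y, p * ζ y, p * τ y]) a v u := by
  set c : ℝ → E3 := fun y => !₂[p * ξ y, p * ζ y, p * τ y] with hc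
  set c' : ℝ → E3 := fun y => !₂[p * ξ' y, p * (ξ y * τ' y), p * τ' y] with hc'
  have dc : ∀ᶠ y in nhds u, HasDerivAt c (c' y) y := by
    filter_upwards [hξ, hζ, hτ] with y h1 h2 h3
    exact hasDerivAt_vec3 (h1.const_mul p) (h2.const_mul p) (h3.const_mul p)
  have dc' : HasDerivAt c' !₂[p * ξ'', p * (ξ' u * τ' u + ξ u * τ''), p * τ''] u :=
    hasDerivAt_vec3 (hξ'.const_mul p) ((hξ.self_of_nhds.mul hτ').const_mul p) (hτ'.const_mul p)
  have hR : IsRegularAt (helicalSurface p c) v u := by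
    rw [isRegularAt_helicalSurface_iff hp dc.self_of_nhds]
    have h1 : c u 0 * c' u 2 - p * c' u 1 = 0 := by
      simp [hc, hc']; ring
    have h2 : p * c' u 0 + c u 1 * c' u 2 = p ^ 2 * (ξ' u + ζ u * τ' u) := by
      simp [hc, hc']; ring
    rw [h1, h2]
    have : p ^ 2 * (ξ' u + ζ u * τ' u) ≠ 0 := mul_ne_zero (pow_ne_zero 2 hp) hreg
    positivity
  refine ⟨hR, (hasCurvatureRatioAt_helicalSurface_iff ha dc dc' hR
    (hx := rfl) (hy := rfl) (hx₁ := rfl) (hy₁ := rfl) (hz₁ := rfl) (hn₁ := rfl) (hn₂ := rfl)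
    (hn₃ := rfl) (hE := rfl) (hF := rfl) (hG := rfl) (hL := rfl) (hM := rfl) (hN := rfl)).2
    ((ratio_condition_iff_reduced (a := a) hp hreg rfl (ψ := 0) (ξ := ξ u)
      ?_ ?_ ?_ ?_ ?_ ?_).2 ⟨hne, hratio⟩)⟩ <;> simp [hc, hc'] <;> ring

theorem explicitSurface_regular_and_ratio {a p C : ℝ} (ha0 : a ≠ 0) (ha1 : a ≠ 1) (ham1 : a ≠ -1)
    (hp : p ≠ 0) (hC : 0 < C) {Z : ℝ → ℝ} (hZ : IsHeight (ratioParam a) C Z) (i : Fin 2) (v : ℝ)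
    {s : ℝ} (hs : s ∈ domainI (ratioParam a) C)
    (hA : (ratioParam a - 1) * s ^ 2 + (ratioParam a + 1) ≠ 0) :
    IsRegularAt (explicitSurface p (ratioParam a) C Z i) v s ∧
      HasCurvatureRatioAt (explicitSurface p (ratioParam a) C Z i) a v s := by
  have hk := ratioParam_pos ha1 ham1
  have hka := ratioParam_sq ham1
  rw [explicitSurface_eq]
  set k := ratioParam a with hkdef
  set ε := profileSign i with hε
  have hε2 : ε ^ 2 = 1 := profileSign_sq i
  have hε0 : ε ≠ 0 := profileSign_ne_zero i
  have hO := isOpen_domainI k C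
  have hev := hO.eventually_mem hs
  -- `k² = 1` would give `4 a = 0`.
  have hk1 : k ^ 2 - 1 ≠ 0 := by
    intro h
    apply ha0
    linear_combination -hka / 4 - (1 + a) ^ 2 / 4 * h
  have dt : DifferentiableAt ℝ (deriv (tFun k C)) s :=
    (((contDiffOn_tFun k C 2).deriv_of_isOpen (m := 1) hO (by norm_num)).differentiableOn
      (by norm_num)).differentiableAt (hO.mem_nhds hs)
  have dz : DifferentiableAt ℝ (fun s => deriv (gFun k C) s / tFun k C s) s :=
    ((contDiffOn_height_deriv hk.ne' hC 1).differentiableOn (by norm_num)).differentiableAt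
      (hO.mem_nhds hs)
  have hs0 : 0 < s := hs.1
  have hh := hFun_pos (k := k) hC hs0
  have ht := tFun_pos hs
  have ht2 := tFun_sq hs
  have hξ1 := (hasDerivAt_tFun hs).deriv
  have hg1 := (hasDerivAt_gFun hk.ne' hC hs0).deriv
  have hr := Real.sqrt_pos.2 hh
  have hr2 := Real.sq_sqrt hh.le
  have hg : gFun k C s = ((k - 1) * s ^ 2 - (k + 1)) / (4 * k * s) * Real.sqrt (hFun k C s) := rfl
  have e0 : 1 + (ε * tFun k C s) ^ 2 = Real.sqrt (hFun k C s) ^ 2 := by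
    rw [hr2, mul_pow, hε2, ht2]; ring
  set A := (k - 1) * s ^ 2 + (k + 1) with hAdef
  rw [← hr2] at hξ1
  set r := Real.sqrt (hFun k C s) with hrdef
  set t := tFun k C s with htdef
  -- `e1` and `e2` evaluate the quantities governing regularity and mean curvature. Each is `A`
  -- times a nonvanishing factor, and inserting them in the ratio equation leaves `(1 - k²) (1 + a)²
  -- = 4 a`.
  have e1 : ε * deriv (tFun k C) s + 2 * gFun k C s * (2 * (ε * (deriv (gFun k C) s / t))) =
      ε * A * r ^ 2 * (k ^ 2 - 1) * (s ^ 2 + 1) / (8 * k ^ 2 * s ^ 3 * t) := by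
    rw [hξ1, hg1, hg]
    field_simp
    ring
  have e2 : r ^ 2 * (2 * (ε * (deriv (gFun k C) s / t))) -
      ε * deriv (tFun k C) s * (2 * gFun k C s) = ε * A * r ^ 3 / (2 * k * s ^ 2 * t) := by
    rw [hξ1, hg1, hg]
    field_simp
    ring
  refine isRegularAt_and_hasCurvatureRatioAt_of_reduced ham1 hp
    (ξ := fun s => ε * tFun k C s) (ζ := fun s => 2 * gFun k C s) (τ := fun s => 2 * (ε * Z s))
    (ξ' := fun s => ε * deriv (tFun k C) s)
    (τ' := fun s => 2 * (ε * (deriv (gFun k C) s / tFun k C s)))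
    (hev.mono fun y hy => ?_) (hev.mono fun y hy => ?_) (hev.mono fun y hy => ?_)
    (dt.hasDerivAt.const_mul ε) ((dz.hasDerivAt.const_mul ε).const_mul 2) ?_ ?_ ?_ v
  · exact (hasDerivAt_tFun hy).differentiableAt.hasDerivAt.const_mul ε
  · refine ((hasDerivAt_gFun hk.ne' hC hy.1).differentiableAt.hasDerivAt.const_mul 2).congr_deriv ?_
    have := (tFun_pos hy).ne'
    field_simp
    rw [hε2, mul_one]
  · exact ((hZ y hy).const_mul ε).const_mul 2
  · refine ne_of_eq_of_ne e1 ?_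
    positivity
  · rw [e0, e2]
    positivity
  · rw [e0, e1, e2, hξ1]
    field_simp
    linear_combination 2 * hka

/-! ### Recovery of the height function -/

/-- The part of the interval where `ε ξ > 0` is again an interval. -/
theorem ordConnected_sign_part {J : Set ℝ} (hJ : J.OrdConnected) {ξ : ℝ → ℝ}
    (hc : ContinuousOn ξ J) (hi : Set.InjOn ξ J) (i : Fin 2) :
    {u ∈ J | 0 < profileSign i * ξ u}.OrdConnected := by
  refine ⟨fun x hx y hy z hz => ?_⟩
  have hsub := hJ.out hx.1 hy.1
  refine ⟨hsub hz, ?_⟩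
  have hxy : x ≤ y := hz.1.trans hz.2
  have hxm : x ∈ Set.Icc x y := ⟨le_rfl, hxy⟩
  have hym : y ∈ Set.Icc x y := ⟨hxy, le_rfl⟩
  have hx2 := hx.2
  have hy2 := hy.2
  rcases ContinuousOn.strictMonoOn_of_injOn_Icc' hxy (hc.mono hsub) (hi.mono hsub) with h | h
  · have h1 := h.monotoneOn hxm hz hz.1
    have h2 := h.monotoneOn hz hym hz.2
    fin_cases i <;> simp [profileSign] at hx2 hy2 ⊢ <;> linarith
  · have h1 := h.antitoneOn hxm hz hz.1
    have h2 := h.antitoneOn hz hym hz.2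
    fin_cases i <;> simp [profileSign] at hx2 hy2 ⊢ <;> linarith

/-- The height of a reduced profile, on the part with given sign of `ξ`, is an antiderivative in
terms of the parameter `s`. -/
theorem IsReducedProfile.exists_height {a k C : ℝ} (hk : k ≠ 0) (hC : 0 < C)
    {J : Set ℝ} (hJ : IsOpen J) (hJc : IsConnected J) {ξ ζ τ ξ' τ' s s' : ℝ → ℝ}
    (h : IsReducedProfile a J ξ ζ τ ξ' τ')
    (hs : ∀ u ∈ J, 0 < s u ∧ hFun k C (s u) = 1 + ξ u ^ 2 ∧ 2 * gFun k C (s u) = ζ u)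
    (hs' : ∀ u ∈ J, ξ u ≠ 0 → HasDerivAt s (s' u) u) (i : Fin 2) :
    ∃ Z : ℝ → ℝ, IsHeight k C Z ∧
      ∀ u ∈ J, 0 < profileSign i * ξ u → τ u = 2 * (profileSign i * Z (s u)) := by
  obtain ⟨Z, hZ⟩ := exists_isHeight hk hC
  set ε := profileSign i with hε
  have hε2 : ε ^ 2 = 1 := profileSign_sq i
  have cξ : ContinuousOn ξ J := fun u hu =>
    (h.hasDerivAt_fst u hu).continuousAt.continuousWithinAt
  set I : Set ℝ := {u ∈ J | 0 < ε * ξ u} with hI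
  have hIo : IsOpen I :=
    (continuousOn_const.mul cξ).isOpen_inter_preimage hJ isOpen_Ioi
  have hIc : I.OrdConnected := ordConnected_sign_part hJc.isPreconnected.ordConnected cξ
    (h.injOn hJc.isPreconnected.ordConnected) i
  rcases I.eq_empty_or_nonempty with he | ⟨u₀, hu₀⟩
  · refine ⟨Z, hZ, fun u hu hp => ?_⟩
    have : u ∈ I := ⟨hu, hp⟩
    simp [he] at this
  have hd : ∀ u ∈ I, HasDerivAt (fun u => τ u - 2 * (ε * Z (s u))) 0 u := by
    rintro u ⟨hu, hp⟩
    have hξ0 : ξ u ≠ 0 := right_ne_zero_of_mul hp.ne'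
    obtain ⟨h1, h2, h3⟩ := hs u hu
    have hdom : s u ∈ domainI k C := ⟨h1, by rw [h2]; have := pow_pos (abs_pos.2 hξ0) 2; simp_all⟩
    have ht : tFun k C (s u) = ε * ξ u := by
      rw [tFun, h2, add_sub_cancel_left, ← Real.sqrt_sq hp.le, mul_pow, hε2, one_mul]
    have hds := hs' u hu hξ0
    -- Differentiating `2 g(s) = ζ` gives `2 g'(s) s' = ξ τ'`; dividing by `ξ = ε t(s)` identifies
    -- `τ'` with `2 ε Z'(s) s'`.
    have hg := ((hasDerivAt_gFun hk hC h1).differentiableAt.hasDerivAt.comp u hds).const_mul 2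
    have hg' := hg.unique ((h.hasDerivAt_snd u hu).congr_of_eventuallyEq
      (Filter.eventually_of_mem (hJ.mem_nhds hu) fun x hx => (hs x hx).2.2))
    refine ((h.hasDerivAt_height u hu).sub
      ((((hZ _ hdom).comp u hds).const_mul ε).const_mul 2)).congr_deriv ?_
    rw [ht]
    have hε0 : ε ≠ 0 := profileSign_ne_zero i
    field_simp
    linear_combination -hg'
  have hconst : ∀ u ∈ I, τ u - 2 * (ε * Z (s u)) = τ u₀ - 2 * (ε * Z (s u₀)) := fun u hu =>
    hIo.is_const_of_deriv_eq_zero hIc.isPreconnected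
      (fun x hx => (hd x hx).differentiableAt.differentiableWithinAt)
      (fun x hx => (hd x hx).deriv) hu hu₀
  refine ⟨fun t => Z t + ε * (τ u₀ - 2 * (ε * Z (s u₀))) / 2, hZ.add_const _, fun u hu hp => ?_⟩
  linear_combination hconst u ⟨hu, hp⟩ - (τ u₀ - 2 * (ε * Z (s u₀))) * hε2

theorem contDiffOn_one_of_hasDerivAt {U : Set ℝ} (hU : IsOpen U) {f f' : ℝ → ℝ}
    (hf : ∀ u ∈ U, HasDerivAt f (f' u) u) (hf' : ContinuousOn f' U) : ContDiffOn ℝ 1 f U := by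
  rw [show (1 : WithTop ℕ∞) = 0 + 1 by simp, contDiffOn_succ_iff_deriv_of_isOpen hU]
  refine ⟨fun u hu => (hf u hu).differentiableAt.differentiableWithinAt, by simp, ?_⟩
  exact contDiffOn_zero.2 (hf'.congr fun u hu => (hf u hu).deriv)

end HelicalCRPC
end

/-! ### Assembly of the two directions -/

theorem theorem3p1 (a p : ℝ) (ha0 : a ≠ 0) (ha1 : a ≠ 1) (ham1 : a ≠ -1) (hp : p ≠ 0) :
    -- every helical surface of pitch `p` with constant ratio `a` is a part of an explicit one
    (∀ (J : Set ℝ) (c : ℝ → HelicalCRPC.E3),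
      IsOpen J → IsConnected J → ContDiffOn ℝ 2 c J →
      (∀ v : ℝ, ∀ u ∈ J,
        HelicalCRPC.IsRegularAt (HelicalCRPC.helicalSurface p c) v u ∧
        HelicalCRPC.HasCurvatureRatioAt (HelicalCRPC.helicalSurface p c) a v u) →
      (HelicalCRPC.axialParams p c J).Subsingleton ∧
      ∃ C : ℝ, 0 < C ∧
      ∃ Z : Fin 2 → ℝ → ℝ,
        (∀ i, HelicalCRPC.IsHeight (HelicalCRPC.ratioParam a) C (Z i)) ∧
      ∃ (i : ℝ → Fin 2) (σ φ : ℝ → ℝ),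
        ContinuousOn i (J \ HelicalCRPC.axialParams p c J) ∧
        ContDiffOn ℝ 1 σ (J \ HelicalCRPC.axialParams p c J) ∧
        ContDiffOn ℝ 1 φ (J \ HelicalCRPC.axialParams p c J) ∧
        ∀ u ∈ J \ HelicalCRPC.axialParams p c J,
          σ u ∈ HelicalCRPC.domainI (HelicalCRPC.ratioParam a) C ∧
          deriv σ u ≠ 0 ∧
          ∀ v : ℝ, HelicalCRPC.helicalSurface p c v u =
            HelicalCRPC.explicitSurface p (HelicalCRPC.ratioParam a) C (Z (i u)) (i u)
              (v + φ u) (σ u)) ∧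
    -- the explicit surfaces, off their singular helix, have constant ratio `a`
    (∀ (C : ℝ) (Z : ℝ → ℝ) (i : Fin 2), 0 < C →
      HelicalCRPC.IsHeight (HelicalCRPC.ratioParam a) C Z →
      ∀ v : ℝ, ∀ s ∈ HelicalCRPC.domainI (HelicalCRPC.ratioParam a) C,
        (HelicalCRPC.ratioParam a - 1) * s ^ 2 + (HelicalCRPC.ratioParam a + 1) ≠ 0 →
        HelicalCRPC.IsRegularAt
          (HelicalCRPC.explicitSurface p (HelicalCRPC.ratioParam a) C Z i) v s ∧
        HelicalCRPC.HasCurvatureRatioAt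
          (HelicalCRPC.explicitSurface p (HelicalCRPC.ratioParam a) C Z i) a v s) := by
  refine ⟨fun J c hJ hJc hc h => ?_, fun C Z i hC hZ v s hs hA =>
    HelicalCRPC.explicitSurface_regular_and_ratio ha0 ha1 ham1 hp hC hZ i v hs hA⟩
  have hk := HelicalCRPC.ratioParam_pos ha1 ham1
  obtain ⟨ξ, ζ, τ, ξ', τ', φ, φ', hred, dφ, cφ', hce, hax⟩ :=
    HelicalCRPC.exists_reduced_profile ha0 ham1 hp hJ hJc hc (h 0)
  have cξ : ContinuousOn ξ J := fun u hu =>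
    (hred.hasDerivAt_fst u hu).continuousAt.continuousWithinAt
  obtain ⟨C, hC, s, s', -, hs, hs', cs'⟩ := hred.exists_parameter ha1 ham1 hJ hJc
  have hZ := hred.exists_height hk.ne' hC hJ hJc hs fun u hu hu0 => (hs' u hu hu0).1
  choose Z hZh hZτ using hZ
  have hdiff : J \ HelicalCRPC.axialParams p c J = {u ∈ J | ξ u ≠ 0} := by
    ext u
    simp only [hax, Set.mem_sdiff, Set.mem_ofPred_eq]
    tauto
  have hU : IsOpen {u ∈ J | ξ u ≠ 0} := cξ.isOpen_inter_preimage hJ isOpen_ne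
  have hsub : {u ∈ J | ξ u ≠ 0} ⊆ J := fun u hu => hu.1
  rw [hdiff]
  -- The index is the sign of `ξ`. As `Fin 2` is discrete, its continuity expresses constancy on
  -- each component.
  refine ⟨?_, C, hC, Z, hZh, fun u => if 0 < ξ u then 0 else 1, s, φ, ?_,
    HelicalCRPC.contDiffOn_one_of_hasDerivAt hU (fun u hu => (hs' u hu.1 hu.2).1) cs',
    HelicalCRPC.contDiffOn_one_of_hasDerivAt hU (fun u hu => dφ u hu.1) (cφ'.mono hsub), ?_⟩
  · rw [hax]
    intro x hx y hy
    exact hred.injOn hJc.isPreconnected.ordConnected hx.1 hy.1 (hx.2.trans hy.2.symm)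
  · intro u hu
    have hcu := cξ.continuousAt (hJ.mem_nhds hu.1)
    apply ContinuousAt.continuousWithinAt
    rcases lt_or_gt_of_ne hu.2 with h0 | h0
    · refine (continuousAt_const (y := (1 : Fin 2))).congr ?_
      filter_upwards [hcu.eventually_lt_const h0] with x hx
      rw [if_neg hx.not_gt]
    · refine (continuousAt_const (y := (0 : Fin 2))).congr ?_
      filter_upwards [hcu.eventually_const_lt h0] with x hx
      rw [if_pos hx]
  · rintro u ⟨hu, hu0⟩
    obtain ⟨h1, h2, h3⟩ := hs u hu
    refine ⟨⟨h1, ?_⟩, ?_, fun v => ?_⟩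
    · have := pow_pos (abs_pos.2 hu0) 2
      rw [sq_abs] at this
      linarith
    · rw [(hs' u hu hu0).1.deriv]
      exact (hs' u hu hu0).2
    · set i : Fin 2 := if 0 < ξ u then 0 else 1 with hi
      have hpos : 0 < HelicalCRPC.profileSign i * ξ u := by
        rcases lt_or_gt_of_ne hu0 with h0 | h0
        · rw [hi, if_neg h0.not_gt]
          simpa [HelicalCRPC.profileSign] using h0
        · rw [hi, if_pos h0]
          simpa [HelicalCRPC.profileSign] using h0
      have ht : HelicalCRPC.profileSign i * HelicalCRPC.tFun (HelicalCRPC.ratioParam a) C (s u) =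
          ξ u := by
        have h4 := HelicalCRPC.profileSign_sq i
        rw [HelicalCRPC.tFun, h2, add_sub_cancel_left, show ξ u ^ 2 =
          (HelicalCRPC.profileSign i * ξ u) ^ 2 by rw [mul_pow, h4, one_mul],
          Real.sqrt_sq hpos.le]
        linear_combination ξ u * h4
      rw [HelicalCRPC.explicitSurface_eq, HelicalCRPC.helicalSurface, HelicalCRPC.helicalSurface,
        HelicalCRPC.helicalMotion_add, hce u hu, ht, h3, ← hZτ i u hu hpos]
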